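/- **Lemma.** Let $4<p<\infty$. *Setting.* For $n\ge 2$, $L,K\in\mathbb N$, let $B_1\subset\mathbb R^n$ be the open unit ball and let $\gamma_1,\dots,\gamma_n$ be complex $L\times L$ matrices describing Clifford multiplication by the standard basis vectors on $\mathbb C^L$, that is, skew-Hermitian matrices with $\gamma_\alpha\gamma_\beta+\gamma_\beta\gamma_\alpha=-2\delta_{\alpha\beta}$; the Euclidean Dirac operator is $\slashed\partial=\sum_{\alpha}\gamma_\alpha\partial_\alpha$. For maps $\varphi,B:B_1\to\mathbb C^L\otimes\mathbb R^K$, with components $\varphi^i,B^i\in\mathbb C^L$, and $A:B_1\to\mathfrak{gl}(L,\mathbb C)\otimes\mathfrak{gl}(K,\mathbb R)$, with blocks $A^i_j\in\mathfrak{gl}(L,\mathbb C)$, we consider the system $$\slashed\partial\varphi^i=A^i_j\varphi^j+B^i,\qquad 1\le i\le K, \tag{1}$$ (summation over $j$) in the weak sense: $-\int_{B_1}\sum_\alpha\partial_\alpha\eta\,\gamma_\alpha\varphi^i\,dx=\int_{B_1}\eta\,(A^i_j\varphi^j+B^i)\,dx$ for all $\eta\in C_c^\infty(B_1)$ and all $i$.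 The fibre $\mathbb C^L\otimes\mathbb R^K$ carries the Euclidean norm, and $|A(x)|$ is the operator norm of $A(x)$ acting on it. For $1\le q<\infty$ and $0\le\lambda\le n$, $M^{q,\lambda}(B_1)$ is the space of $u\in L^q(B_1)$ with $$\|u\|_{M^{q,\lambda}(B_1)}=\sup_{x\in B_1,\,r>0}\Big(\frac{r^\lambda}{r^n}\int_{B_r(x)\cap B_1}|u|^q\,dy\Big)^{1/q}<\infty .$$ **(a)** For every $n\ge2$ there is $\varepsilon_0=\varepsilon_0(n,p)>0$ such that the following holds for all $L,K$ and $\gamma$. If $\varphi\in M^{4,2}(B_1)$ is a weak solution of (1) with $A\in M^{2,2}(B_1)$, $B\in M^{2,2}(B_1)$ and $\|A\|_{M^{2,2}(B_1)}\le\varepsilon_0$, then $\varphi\in L^p_{loc}(B_1)$. Moreover, for every open $U$ with compact closure in $B_1$ there is a constant $C=C(n,p,U)$ such that for all such $\varphi$, $A$, $B$ $$\|\varphi\|_{L^p(U)}\le C\big(\|\varphi\|_{M^{4,2}(B_1)}+\|B\|_{M^{2,2}(B_1)}\big).$$ **(b)** (The case $n=2$, $L=2$.) There is $\varepsilon_0=\varepsilon_0(p)>0$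 such that for all $K$ and $\gamma$: if $n=2$, $L=2$, and $\varphi\in L^4(B_1)$ is a weak solution of (1) with $A\in L^2(B_1)$, $B\in L^2(B_1)$ and $\|A\|_{L^2(B_1)}\le\varepsilon_0$, then $\varphi\in L^p_{loc}(B_1)$. -/

import Mathlib

open MeasureTheory Metric
open scoped ENNReal Matrix Kronecker ContDiff

/-- The `(q, lam)`-Morrey norm on `U ⊆ ℝⁿ`,
`sup_{x ∈ U, r > 0} (r ^ lam / r ^ n * ∫_{B_r(x) ∩ U} |u| ^ q) ^ (1 / q)`, with values in `[0, ∞]`. -/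
noncomputable def morreyNorm {n : ℕ} {F : Type*} [NormedAddCommGroup F] (q lam : ℝ)
    (U : Set (EuclideanSpace ℝ (Fin n))) (u : EuclideanSpace ℝ (Fin n) → F) : ℝ≥0∞ :=
  ⨆ x ∈ U, ⨆ r : ℝ, ⨆ _ : 0 < r,
    (ENNReal.ofReal (r ^ lam / r ^ n) * ∫⁻ y in ball x r ∩ U, ‖u y‖ₑ ^ q) ^ (1 / q)

/-- Membership in the Morrey space `M^{q, lam}(U)`. -/
def MemMorrey {n : ℕ} {F : Type*} [NormedAddCommGroup F] (q lam : ℝ)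
    (U : Set (EuclideanSpace ℝ (Fin n))) (u : EuclideanSpace ℝ (Fin n) → F) : Prop :=
  MemLp u (ENNReal.ofReal q) (volume.restrict U) ∧ morreyNorm q lam U u < ⊤

/-- Membership in `L^q_loc(U)`: `u` is in `L^q(Q)` for every compact `Q ⊆ U`. -/
def MemLocLp {n : ℕ} {F : Type*} [NormedAddCommGroup F] (q : ℝ)
    (U : Set (EuclideanSpace ℝ (Fin n))) (u : EuclideanSpace ℝ (Fin n) → F) : Prop :=
  ∀ Q : Set (EuclideanSpace ℝ (Fin n)), IsCompact Q → Q ⊆ U →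
    MemLp u (ENNReal.ofReal q) (volume.restrict Q)

/-- The fibre `ℂ^L ⊗ ℝ^K` with its Euclidean norm. The coordinate `(i, a)` of `v` is the `a`-th
coordinate of the component `v^i ∈ ℂ^L`. -/
abbrev TwistedSpinor (L K : ℕ) : Type := EuclideanSpace ℂ (Fin K × Fin L)

/-- Elements of `gl(L, ℂ) ⊗ gl(K, ℝ)`: the entry at `(i, a), (j, b)` is the entry at `a, b` of the
block `A^i_j ∈ gl(L, ℂ)`. -/
abbrev TwistedEnd (L K : ℕ) : Type := Matrix (Fin K × Fin L) (Fin K × Fin L) ℂ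

/-- The action `(A v)^i = ∑ j, A^i_j v^j` of `gl(L, ℂ) ⊗ gl(K, ℝ)` on `ℂ^L ⊗ ℝ^K`, as a bounded
operator. Its norm is the operator norm of the matrix. -/
noncomputable abbrev TwistedEnd.op {L K : ℕ} (A : TwistedEnd L K) :
    TwistedSpinor L K →L[ℂ] TwistedSpinor L K :=
  Matrix.toEuclideanCLM (n := Fin K × Fin L) (𝕜 := ℂ) A

/-- Clifford multiplication by the standard basis vectors `e_α` of `ℝⁿ` on `ℂ^L`, for the negative
definite form: `e_α e_β + e_β e_α = -2 δ_{αβ}`, with each `e_α` acting skew-adjointly. -/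
structure IsCliffordMul {n L : ℕ} (γ : Fin n → Matrix (Fin L) (Fin L) ℂ) : Prop where
  anticomm : ∀ α β, γ α * γ β + γ β * γ α =
    if α = β then (-2 : ℂ) • (1 : Matrix (Fin L) (Fin L) ℂ) else 0
  skew : ∀ α, (γ α)ᴴ = -γ α

/-- `φ` is a weak solution on the open set `U` of `∂̸ φ^i = A^i_j φ^j + B^i`, `1 ≤ i ≤ K`, where
`∂̸ = ∑ α, e_α · ∂_α` acts on the factor `ℂ^L` (so `e_α` acts on `ℂ^L ⊗ ℝ^K` through `1 ⊗ γ α`):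
the derivatives are moved to the test functions `η ∈ C_c^∞(U)`. -/
def IsWeakDiracSolution {n L K : ℕ} (γ : Fin n → Matrix (Fin L) (Fin L) ℂ)
    (U : Set (EuclideanSpace ℝ (Fin n)))
    (A : EuclideanSpace ℝ (Fin n) → TwistedEnd L K)
    (B φ : EuclideanSpace ℝ (Fin n) → TwistedSpinor L K) : Prop :=
  ∀ η : EuclideanSpace ℝ (Fin n) → ℝ, ContDiff ℝ ∞ η → HasCompactSupport η → tsupport η ⊆ U →
    -∫ x in U, ∑ α : Fin n, fderiv ℝ η x (EuclideanSpace.single α 1) •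
        TwistedEnd.op ((1 : Matrix (Fin K) (Fin K) ℂ) ⊗ₖ γ α) (φ x) =
      ∫ x in U, η x • (TwistedEnd.op (A x) (φ x) + B x)

/-!
Let `χ` be a cutoff function. The localised spinor `ψ = χ φ` solves `∂̸ψ = A ψ + χ B + dχ · φ`, so
convolution with the fundamental solution of `∂̸`, which is homogeneous of degree `1 - n`, gives

  `|ψ| ≤ S_{c|A|} |ψ| + S_w 1`, `w = c (|B| + |dχ| |φ|)`,
  `S_a u (x) = ∫_{B₁} |x - y| ^ (1 - n) a(y) u(y) dy`,

almost everywhere in the unit ball (`exists_enorm_le_lintegral_powKernel`). From here on only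
nonnegative functions occur. For `a ∈ M^{2,2}` the operator `S_a` is bounded on the Morrey space
`M^{q,1}` for every `q ≥ 2`, with norm at most a constant times that of `a`
(`exists_morreyBound_rieszOp`). The exponent `1` is chosen below the critical exponent
`q / (q - 1)`, so that the estimate follows from Hölder's inequality and Tonelli's theorem alone,
while `M^{4,2}` still embeds into `M^{2,1}`.

If `A` is small in `M^{2,2}`, then `S_{c|A|}` is a contraction both on `M^{2,1}`, which contains
`|ψ|`, and on `M^{p,1}`, which contains `S_w 1` because `w ∈ M^{2,2}`. Iterating the inequality,
`|ψ|` is dominated by the Neumann series of `S_w 1`, which converges in `M^{p,1} ⊆ L^p`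
(`MorreyBound.of_le_rieszOp_add`). This gives the local `L^p` estimate. In dimension two
`M^{q,2} = L^q`, so the second part is a special case of the first.

To derive the pointwise bound without a principal value, the weak equation is tested with
`χ(y) z_β κ(z)`, `z = y - x`, where `κ` is a smooth function equal to `|z| ^ (-n)` off a small ball.
Contracting with Clifford multiplication by `e_β`, the Clifford relations turn the derivatives of
the kernel into the divergence of `z κ(z)`, an approximate identity supported in that ball, and the
Lebesgue differentiation theorem applies.
-/

/-! ### Integrals of power kernels and Morrey bounds -/

/-- The power kernel `z ↦ |z| ^ (-b)` with values in `[0, ∞]`. For `b > 0` the convention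
`0 ^ (-b) = 0` for real powers gives it the value `0` at the origin, which is harmless for Lebesgue
integrals and makes the pointwise bounds below hold there too. -/
noncomputable def powKernel {n : ℕ} (b : ℝ) (z : EuclideanSpace ℝ (Fin n)) : ℝ≥0∞ :=
  ENNReal.ofReal (‖z‖ ^ (-b))

theorem measurable_powKernel {n : ℕ} (b : ℝ) :
    Measurable (powKernel b : EuclideanSpace ℝ (Fin n) → ℝ≥0∞) := by
  unfold powKernel
  fun_prop

theorem powKernel_zero {n : ℕ} {b : ℝ} (hb : 0 < b) :
    powKernel b (0 : EuclideanSpace ℝ (Fin n)) = 0 := by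
  simp [powKernel, Real.zero_rpow (neg_ne_zero.2 hb.ne')]

theorem shell_rpow_mul_rpow {b m θ r : ℝ} (hθ : 0 < θ) (hr : 0 < r) (k : ℕ) :
    (θ ^ k * r / 2) ^ (-b) * (2 * (θ ^ k * r)) ^ m =
      2 ^ (b + m) * r ^ (m - b) * (θ ^ (m - b)) ^ k := by
  have hk : 0 < θ ^ k := pow_pos hθ k
  have hρ : 0 < θ ^ k * r := mul_pos hk hr
  have h2 : (0 : ℝ) < 2 := two_pos
  have e1 : (θ ^ (m - b)) ^ k = (θ ^ k) ^ (m - b) := by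
    rw [← Real.rpow_natCast, ← Real.rpow_natCast, ← Real.rpow_mul hθ.le, ← Real.rpow_mul hθ.le,
      mul_comm]
  rw [e1, Real.div_rpow hρ.le h2.le, Real.mul_rpow h2.le hρ.le, Real.mul_rpow hk.le hr.le,
    Real.mul_rpow hk.le hr.le, Real.rpow_neg h2.le, Real.rpow_add h2, sub_eq_add_neg,
    Real.rpow_add hr, Real.rpow_add hk]
  have : (2 : ℝ) ^ b ≠ 0 := (Real.rpow_pos_of_pos h2 b).ne'
  field_simp

/-- If `ν(B_ρ(x)) ≤ M ρ ^ m` for all `ρ`, the integral of `|x - y| ^ (-b)` over a set covered by the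
shells `|x - y| ~ θ ^ k r` is a convergent geometric series as soon as `θ ^ (m - b) < 1`. -/
theorem lintegral_powKernel_le_of_shells {n : ℕ} {b m θ : ℝ} (hb : 0 < b) (hθ : 0 < θ)
    (hθ1 : θ ^ (m - b) < 1)
    (ν : Measure (EuclideanSpace ℝ (Fin n))) (x : EuclideanSpace ℝ (Fin n)) (M : ℝ≥0∞)
    (hν : ∀ ρ : ℝ, 0 < ρ → ν (ball x ρ) ≤ M * ENNReal.ofReal (ρ ^ m)) {r : ℝ} (hr : 0 < r)
    (s : Set (EuclideanSpace ℝ (Fin n)))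
    (hs : ∀ y ∈ s, y ≠ x → ∃ k : ℕ, θ ^ k * r / 2 ≤ dist y x ∧ dist y x < 2 * (θ ^ k * r)) :
    ∫⁻ y in s, powKernel b (x - y) ∂ν ≤
      ENNReal.ofReal (2 ^ (b + m) * (1 - θ ^ (m - b))⁻¹) * M * ENNReal.ofReal (r ^ (m - b)) := by
  have hρ : ∀ k : ℕ, 0 < θ ^ k * r := fun k => mul_pos (pow_pos hθ k) hr
  have hpt : ∀ y ∈ s, powKernel b (x - y) ≤
      ∑' k : ℕ, (ball x (2 * (θ ^ k * r))).indicator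
        (fun _ => ENNReal.ofReal ((θ ^ k * r / 2) ^ (-b))) y := by
    intro y hy
    rcases eq_or_ne y x with rfl | hne
    · simp [powKernel_zero hb]
    obtain ⟨k, hk1, hk2⟩ := hs y hy hne
    refine le_trans ?_ (ENNReal.le_tsum k)
    rw [Set.indicator_of_mem (by simpa using hk2)]
    refine ENNReal.ofReal_le_ofReal ?_
    rw [← dist_eq_norm, dist_comm]
    exact Real.rpow_le_rpow_of_nonpos (by linarith [hρ k]) hk1 (by linarith)
  calc ∫⁻ y in s, powKernel b (x - y) ∂ν
      ≤ ∫⁻ y in s, ∑' k : ℕ, (ball x (2 * (θ ^ k * r))).indicator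
        (fun _ => ENNReal.ofReal ((θ ^ k * r / 2) ^ (-b))) y ∂ν := by
        refine setLIntegral_mono ?_ hpt
        exact Measurable.tsum fun k => measurable_const.indicator measurableSet_ball
    _ ≤ ∫⁻ y, ∑' k : ℕ, (ball x (2 * (θ ^ k * r))).indicator
        (fun _ => ENNReal.ofReal ((θ ^ k * r / 2) ^ (-b))) y ∂ν := setLIntegral_le_lintegral _ _
    _ = ∑' k : ℕ, ENNReal.ofReal ((θ ^ k * r / 2) ^ (-b)) * ν (ball x (2 * (θ ^ k * r))) := by
        rw [lintegral_tsum fun k =>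
          (measurable_const.indicator measurableSet_ball).aemeasurable]
        simp_rw [lintegral_indicator_const measurableSet_ball]
    _ ≤ ∑' k : ℕ, M * ENNReal.ofReal (2 ^ (b + m) * r ^ (m - b)) *
          ENNReal.ofReal (θ ^ (m - b)) ^ k := by
        refine ENNReal.tsum_le_tsum fun k => ?_
        refine (mul_le_mul_right (hν _ (by linarith [hρ k])) _).trans (le_of_eq ?_)
        rw [mul_left_comm, ← ENNReal.ofReal_mul (by have := hρ k; positivity),
          shell_rpow_mul_rpow hθ hr, ENNReal.ofReal_mul (by positivity),
          ENNReal.ofReal_pow (by positivity), mul_assoc]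
    _ = _ := by
        rw [ENNReal.tsum_mul_left, ENNReal.tsum_geometric,
          ← ENNReal.ofReal_one, ← ENNReal.ofReal_sub _ (by positivity),
          ← ENNReal.ofReal_inv_of_pos (by linarith),
          ENNReal.ofReal_mul (by positivity), ENNReal.ofReal_mul (by positivity)]
        ring

theorem exists_lintegral_powKernel_ball_le {n : ℕ} {b m : ℝ} (hb : 0 < b) (hbm : b < m) :
    ∃ C : ℝ≥0∞, C ≠ ⊤ ∧ ∀ (ν : Measure (EuclideanSpace ℝ (Fin n))) (x : EuclideanSpace ℝ (Fin n))
      (M : ℝ≥0∞), (∀ ρ : ℝ, 0 < ρ → ν (ball x ρ) ≤ M * ENNReal.ofReal (ρ ^ m)) →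
      ∀ r : ℝ, 0 < r →
        ∫⁻ y in ball x r, powKernel b (x - y) ∂ν ≤ C * M * ENNReal.ofReal (r ^ (m - b)) := by
  refine ⟨_, ENNReal.ofReal_ne_top, fun ν x M hν r hr =>
    lintegral_powKernel_le_of_shells hb (θ := 1 / 2) (by norm_num)
      (Real.rpow_lt_one (by norm_num) (by norm_num) (by linarith)) ν x M hν hr _ ?_⟩
  intro y hy hne
  have hd : 0 < dist y x := dist_pos.2 hne
  have hlt : dist y x < r := hy
  obtain ⟨k, h1, h2⟩ := exists_nat_pow_near_of_lt_one (div_pos hd hr)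
    ((div_le_one hr).2 hlt.le) (by norm_num : (0 : ℝ) < 1 / 2) (by norm_num)
  rw [lt_div_iff₀ hr, pow_succ] at h1
  rw [div_le_iff₀ hr] at h2
  exact ⟨k, by linarith, by linarith⟩

theorem exists_lintegral_powKernel_compl_ball_le {n : ℕ} {b m : ℝ} (hb : 0 < b) (hbm : m < b) :
    ∃ C : ℝ≥0∞, C ≠ ⊤ ∧ ∀ (ν : Measure (EuclideanSpace ℝ (Fin n))) (x : EuclideanSpace ℝ (Fin n))
      (M : ℝ≥0∞), (∀ ρ : ℝ, 0 < ρ → ν (ball x ρ) ≤ M * ENNReal.ofReal (ρ ^ m)) →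
      ∀ r : ℝ, 0 < r →
        ∫⁻ y in (ball x r)ᶜ, powKernel b (x - y) ∂ν ≤ C * M * ENNReal.ofReal (r ^ (m - b)) := by
  refine ⟨_, ENNReal.ofReal_ne_top, fun ν x M hν r hr =>
    lintegral_powKernel_le_of_shells hb (θ := 2) (by norm_num)
      (Real.rpow_lt_one_of_one_lt_of_neg (by norm_num) (by linarith)) ν x M hν hr _ ?_⟩
  intro y hy hne
  have hle : r ≤ dist y x := by simpa using hy
  obtain ⟨k, h1, h2⟩ := exists_nat_pow_near ((one_le_div hr).2 hle) (one_lt_two (α := ℝ))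
  rw [le_div_iff₀ hr] at h1
  rw [div_lt_iff₀ hr, pow_succ] at h2
  have : 0 < (2 : ℝ) ^ k * r := by positivity
  exact ⟨k, by linarith, by linarith⟩

/-- `v` lies in the Morrey space `M^{q, n - m}` of the unit ball of `ℝⁿ` with norm at most `N`, in
the form `∫_{B_r(x) ∩ B_1} v ^ q ≤ N ^ q r ^ m`; `m` is the growth exponent of these integrals. -/
def MorreyBound {n : ℕ} (q m : ℝ) (v : EuclideanSpace ℝ (Fin n) → ℝ≥0∞) (N : ℝ≥0∞) : Prop :=
  ∀ x ∈ ball (0 : EuclideanSpace ℝ (Fin n)) 1, ∀ r : ℝ, 0 < r →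
    ∫⁻ y in ball x r ∩ ball 0 1, v y ^ q ≤ N ^ q * ENNReal.ofReal (r ^ m)

/-- The Riesz potential of order one of `a u` over the unit ball,
`S_a u (x) = ∫_{B_1} |x - y| ^ (1 - n) a(y) u(y) dy`, for nonnegative `a` and `u`. -/
noncomputable def rieszOp {n : ℕ} (a u : EuclideanSpace ℝ (Fin n) → ℝ≥0∞)
    (x : EuclideanSpace ℝ (Fin n)) : ℝ≥0∞ :=
  ∫⁻ y in ball 0 1, powKernel ((n : ℝ) - 1) (x - y) * (a y * u y)

/-- The volume of the unit ball of `ℝⁿ`. -/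
noncomputable def unitBallVol (n : ℕ) : ℝ≥0∞ := volume (ball (0 : EuclideanSpace ℝ (Fin n)) 1)

theorem unitBallVol_ne_top (n : ℕ) : unitBallVol n ≠ ⊤ := measure_ball_lt_top.ne

theorem volume_ball_eq {n : ℕ} (x : EuclideanSpace ℝ (Fin n)) {r : ℝ} (hr : 0 < r) :
    volume (ball x r) = unitBallVol n * ENNReal.ofReal (r ^ (n : ℝ)) := by
  rw [Measure.addHaar_ball_of_pos _ _ hr, unitBallVol, mul_comm]
  simp

theorem volume_ball_inter_le {n : ℕ} (x : EuclideanSpace ℝ (Fin n)) {r m : ℝ} (hr : 0 < r)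
    (hm : 0 ≤ m) (hmn : m ≤ n) :
    volume (ball x r ∩ ball 0 1) ≤ unitBallVol n * ENNReal.ofReal (r ^ m) := by
  rcases le_total r 1 with h | h
  · refine (measure_mono Set.inter_subset_left).trans ?_
    rw [volume_ball_eq x hr]
    exact mul_le_mul' le_rfl
      (ENNReal.ofReal_le_ofReal (Real.rpow_le_rpow_of_exponent_ge hr h hmn))
  · refine (measure_mono Set.inter_subset_right).trans ?_
    refine le_mul_of_one_le_right' ?_
    rw [ENNReal.one_le_ofReal]
    exact Real.one_le_rpow h hm

theorem MorreyBound.congr {n : ℕ} {q m : ℝ} {v w : EuclideanSpace ℝ (Fin n) → ℝ≥0∞} {N : ℝ≥0∞}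
    (hv : MorreyBound q m v N) (h : v =ᵐ[volume.restrict (ball 0 1)] w) : MorreyBound q m w N := by
  intro x hx r hr
  refine le_trans (le_of_eq ?_) (hv x hx r hr)
  refine lintegral_congr_ae ?_
  filter_upwards [ae_restrict_of_ae_restrict_of_subset Set.inter_subset_right h] with y hy
  rw [hy]

theorem MorreyBound.mono {n : ℕ} {q m : ℝ} (hq : 0 ≤ q)
    {v w : EuclideanSpace ℝ (Fin n) → ℝ≥0∞} {N N' : ℝ≥0∞}
    (hv : MorreyBound q m v N) (h : ∀ x, w x ≤ v x) (hN : N ≤ N') : MorreyBound q m w N' := by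
  intro x hx r hr
  refine le_trans ?_ ((hv x hx r hr).trans (by gcongr))
  exact lintegral_mono fun y => ENNReal.rpow_le_rpow (h y) hq

theorem MorreyBound.const_mul {n : ℕ} {q m : ℝ} (hq : 0 ≤ q)
    {v : EuclideanSpace ℝ (Fin n) → ℝ≥0∞} {N : ℝ≥0∞}
    (hv : MorreyBound q m v N) (hm : Measurable v) (c : ℝ≥0∞) :
    MorreyBound q m (fun x => c * v x) (c * N) := by
  intro x hx r hr
  simp_rw [ENNReal.mul_rpow_of_nonneg _ _ hq]
  rw [lintegral_const_mul _ (hm.pow_const q), mul_assoc]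
  gcongr
  exact hv x hx r hr

theorem MorreyBound.add {n : ℕ} {q m : ℝ} (hq : 1 ≤ q)
    {v w : EuclideanSpace ℝ (Fin n) → ℝ≥0∞} {N N' : ℝ≥0∞}
    (hv : MorreyBound q m v N) (hw : MorreyBound q m w N')
    (hvm : Measurable v) (hwm : Measurable w) :
    MorreyBound q m (fun x => v x + w x) (N + N') := by
  intro x hx r hr
  have hq0 : 0 < q := by linarith
  set R := ENNReal.ofReal (r ^ m)
  have key : ∀ {f : EuclideanSpace ℝ (Fin n) → ℝ≥0∞} {L : ℝ≥0∞},
      ∫⁻ y in ball x r ∩ ball 0 1, f y ^ q ≤ L ^ q * R →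
      (∫⁻ y in ball x r ∩ ball 0 1, f y ^ q) ^ (1 / q) ≤ L * R ^ (1 / q) := by
    intro f L h
    refine (ENNReal.rpow_le_rpow h (by positivity)).trans (le_of_eq ?_)
    rw [ENNReal.mul_rpow_of_nonneg _ _ (by positivity), ← ENNReal.rpow_mul,
      mul_one_div_cancel hq0.ne', ENNReal.rpow_one]
  have h := (ENNReal.lintegral_Lp_add_le (μ := volume.restrict (ball x r ∩ ball 0 1))
    hvm.aemeasurable hwm.aemeasurable hq).trans
    (add_le_add (key (hv x hx r hr)) (key (hw x hx r hr)))
  rw [← add_mul] at h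
  have h' := ENNReal.rpow_le_rpow h hq0.le
  rw [← ENNReal.rpow_mul, one_div_mul_cancel hq0.ne', ENNReal.rpow_one,
    ENNReal.mul_rpow_of_nonneg _ _ hq0.le, ← ENNReal.rpow_mul, one_div_mul_cancel hq0.ne',
    ENNReal.rpow_one] at h'
  exact h'

theorem MorreyBound.one {n : ℕ} (hn : 1 ≤ n) {q : ℝ} (hq : 0 < q) :
    MorreyBound q ((n : ℝ) - 1) (fun _ : EuclideanSpace ℝ (Fin n) => (1 : ℝ≥0∞))
      (unitBallVol n ^ (1 / q)) := by
  intro x _ r hr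
  have h1 : (1 : ℝ) ≤ n := by exact_mod_cast hn
  rw [← ENNReal.rpow_mul, one_div_mul_cancel hq.ne', ENNReal.rpow_one]
  simpa using volume_ball_inter_le x hr (by linarith) (by linarith : (n : ℝ) - 1 ≤ n)

/-! ### The Riesz potential on Morrey spaces -/

theorem measurable_rieszOp {n : ℕ} {a u : EuclideanSpace ℝ (Fin n) → ℝ≥0∞}
    (ha : Measurable a) (hu : Measurable u) : Measurable (rieszOp a u) := by
  unfold rieszOp
  refine Measurable.lintegral_prod_right
    (f := fun x y : EuclideanSpace ℝ (Fin n) =>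
      powKernel ((n : ℝ) - 1) (x - y) * (a y * u y)) ?_
  have := (measurable_powKernel (n := n) ((n : ℝ) - 1)).comp (measurable_fst.sub measurable_snd)
  exact this.mul ((ha.comp measurable_snd).mul (hu.comp measurable_snd))

theorem powKernel_mul_rpow {n : ℕ} {b b₁ b₂ θ₁ θ₂ : ℝ} (hb : 0 < b) (h₁ : 0 < b₁)
    (hθ₁ : 0 < θ₁) (hθ₂ : 0 ≤ θ₂) (h : b₁ * θ₁ + b₂ * θ₂ = b) (z : EuclideanSpace ℝ (Fin n)) :
    powKernel b z = powKernel b₁ z ^ θ₁ * powKernel b₂ z ^ θ₂ := by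
  rcases eq_or_ne z 0 with rfl | hz
  · rw [powKernel_zero hb, powKernel_zero h₁, ENNReal.zero_rpow_of_pos hθ₁, zero_mul]
  have hz' : 0 < ‖z‖ := norm_pos_iff.2 hz
  unfold powKernel
  rw [ENNReal.ofReal_rpow_of_nonneg (by positivity) hθ₁.le,
    ENNReal.ofReal_rpow_of_nonneg (by positivity) hθ₂, ← ENNReal.ofReal_mul (by positivity),
    ← Real.rpow_mul hz'.le, ← Real.rpow_mul hz'.le, ← Real.rpow_add hz', ← h]
  congr 2
  ring

/-- Hölder's inequality with exponents `2`, `q` and `2q / (q - 2)`: the measure `a u dy` on the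
unit ball grows like `ρ ^ (n - 1 - 1 / q)`. -/
theorem lintegral_mul_le_of_morreyBound {n : ℕ} {q : ℝ} (hq : 2 ≤ q)
    {a u : EuclideanSpace ℝ (Fin n) → ℝ≥0∞} {Na Nu : ℝ≥0∞} (ha : Measurable a) (hu : Measurable u)
    (hA : MorreyBound 2 ((n : ℝ) - 2) a Na) (hU : MorreyBound q ((n : ℝ) - 1) u Nu)
    {x : EuclideanSpace ℝ (Fin n)} (hx : x ∈ ball 0 1) {ρ : ℝ} (hρ : 0 < ρ) :
    ∫⁻ y in ball x ρ ∩ ball 0 1, a y * u y ≤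
      unitBallVol n ^ (1 / 2 - 1 / q) * (Na * Nu) * ENNReal.ofReal (ρ ^ ((n : ℝ) - 1 - 1 / q)) := by
  have hq0 : 0 < q := by linarith
  have hθ : 0 ≤ 1 / 2 - 1 / q := by
    rw [sub_nonneg]; exact one_div_le_one_div_of_le two_pos hq
  set μ := volume.restrict (ball x ρ ∩ ball (0 : EuclideanSpace ℝ (Fin n)) 1)
  have h := ENNReal.lintegral_prod_norm_pow_le (μ := μ) (Finset.univ : Finset (Fin 3))
    (f := ![fun y => a y ^ (2 : ℝ), fun y => u y ^ q, fun _ => 1])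
    (p := ![1 / 2, 1 / q, 1 / 2 - 1 / q])
    (by
      intro i _
      fin_cases i
      · exact (ha.pow_const _).aemeasurable
      · exact (hu.pow_const _).aemeasurable
      · exact aemeasurable_const)
    (by simp [Fin.sum_univ_three]; norm_num)
    (by
      intro i _
      fin_cases i
      · simp
      · simp [hq0.le]
      · exact hθ)
  simp only [Fin.prod_univ_three, Matrix.cons_val_zero, Matrix.cons_val_one, Matrix.cons_val_two,
    Matrix.head_cons, Matrix.tail_cons, ENNReal.one_rpow, mul_one, ← ENNReal.rpow_mul,
    mul_one_div_cancel hq0.ne', lintegral_one] at h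
  have e2 : (2 : ℝ) * (1 / 2) = 1 := by norm_num
  simp only [e2, ENNReal.rpow_one] at h
  refine h.trans ?_
  have i1 := ENNReal.rpow_le_rpow (hA x hx ρ hρ) (by norm_num : (0 : ℝ) ≤ 1 / 2)
  have i2 := ENNReal.rpow_le_rpow (hU x hx ρ hρ) (by positivity : (0 : ℝ) ≤ 1 / q)
  have i3 : (μ Set.univ) ^ (1 / 2 - 1 / q) ≤
      (unitBallVol n * ENNReal.ofReal (ρ ^ (n : ℝ))) ^ (1 / 2 - 1 / q) := by
    refine ENNReal.rpow_le_rpow ?_ hθ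
    rw [Measure.restrict_apply_univ]
    exact (measure_mono Set.inter_subset_left).trans (volume_ball_eq x hρ).le
  refine (mul_le_mul' (mul_le_mul' i1 i2) i3).trans (le_of_eq ?_)
  rw [ENNReal.mul_rpow_of_nonneg _ _ (by norm_num), ENNReal.mul_rpow_of_nonneg _ _ (by positivity),
    ENNReal.mul_rpow_of_nonneg _ _ hθ, ← ENNReal.rpow_mul, ← ENNReal.rpow_mul, e2,
    mul_one_div_cancel hq0.ne', ENNReal.rpow_one, ENNReal.rpow_one,
    ENNReal.ofReal_rpow_of_nonneg (by positivity) (by norm_num),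
    ENNReal.ofReal_rpow_of_nonneg (by positivity) (by positivity),
    ENNReal.ofReal_rpow_of_nonneg (by positivity) hθ, ← Real.rpow_mul hρ.le, ← Real.rpow_mul hρ.le,
    ← Real.rpow_mul hρ.le]
  have e : ρ ^ ((n : ℝ) - 1 - 1 / q) = ρ ^ (((n : ℝ) - 2) * (1 / 2)) *
      ρ ^ (((n : ℝ) - 1) * (1 / q)) * ρ ^ ((n : ℝ) * (1 / 2 - 1 / q)) := by
    rw [← Real.rpow_add hρ, ← Real.rpow_add hρ]
    congr 1
    ring
  rw [e, ENNReal.ofReal_mul (by positivity), ENNReal.ofReal_mul (by positivity)]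
  ring

/-- Tonelli's theorem for the part of a potential near the diagonal. -/
theorem lintegral_lintegral_powKernel_near_le {n : ℕ} {c : ℝ}
    (ν : Measure (EuclideanSpace ℝ (Fin n)))
    [SFinite ν] {C : ℝ≥0∞} {r : ℝ}
    (hC : ∀ y : EuclideanSpace ℝ (Fin n), ∫⁻ x in ball y r, powKernel c (y - x) ≤ C)
    (x₀ : EuclideanSpace ℝ (Fin n)) :
    ∫⁻ x in ball x₀ r, ∫⁻ y in ball x r, powKernel c (x - y) ∂ν ≤ C * ν (ball x₀ (2 * r)) := by
  set D : Set (EuclideanSpace ℝ (Fin n) × EuclideanSpace ℝ (Fin n)) :=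
    {z | dist z.2 z.1 < r} ∩ {z | z.1 ∈ ball x₀ r}
  have hD : MeasurableSet D :=
    (isOpen_lt (continuous_snd.dist continuous_fst) continuous_const).measurableSet.inter
      (measurable_fst measurableSet_ball)
  set F : EuclideanSpace ℝ (Fin n) → EuclideanSpace ℝ (Fin n) → ℝ≥0∞ :=
    fun x y => D.indicator (fun z => powKernel c (z.1 - z.2)) (x, y)
  have hF : Measurable (Function.uncurry F) :=
    ((measurable_powKernel c).comp (measurable_fst.sub measurable_snd)).indicator hD
  have e1 : ∫⁻ x in ball x₀ r, ∫⁻ y in ball x r, powKernel c (x - y) ∂ν =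
      ∫⁻ x, ∫⁻ y, F x y ∂ν := by
    rw [← lintegral_indicator measurableSet_ball]
    refine lintegral_congr fun x => ?_
    by_cases hx : x ∈ ball x₀ r
    · rw [Set.indicator_of_mem hx, ← lintegral_indicator measurableSet_ball]
      refine lintegral_congr fun y => ?_
      simp only [F]
      by_cases hy : y ∈ ball x r
      · rw [Set.indicator_of_mem hy, Set.indicator_of_mem (show (x, y) ∈ D from ⟨hy, hx⟩)]
      · rw [Set.indicator_of_notMem hy, Set.indicator_of_notMem fun h : (x, y) ∈ D => hy h.1]
    · rw [Set.indicator_of_notMem hx]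
      refine (lintegral_eq_zero_of_ae_eq_zero (Filter.Eventually.of_forall fun y => ?_)).symm
      exact Set.indicator_of_notMem (fun h : (x, y) ∈ D => hx h.2) _
  rw [e1, lintegral_lintegral_swap hF.aemeasurable, ← setLIntegral_const,
    ← lintegral_indicator measurableSet_ball]
  refine lintegral_mono fun y => ?_
  by_cases hy : y ∈ ball x₀ (2 * r)
  · rw [Set.indicator_of_mem hy]
    refine le_trans ?_ (hC y)
    rw [← lintegral_indicator measurableSet_ball]
    refine lintegral_mono fun x => ?_
    by_cases hx : (x, y) ∈ D
    · have : x ∈ ball y r := by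
        have h1 : dist y x < r := hx.1
        rwa [mem_ball, dist_comm]
      simp only [F]
      rw [Set.indicator_of_mem hx, Set.indicator_of_mem this, powKernel, powKernel, norm_sub_rev]
    · simp only [F]
      rw [Set.indicator_of_notMem hx]
      exact zero_le
  · rw [Set.indicator_of_notMem hy]
    refine (lintegral_eq_zero_of_ae_eq_zero (Filter.Eventually.of_forall fun x => ?_)).le
    refine Set.indicator_of_notMem (fun h : (x, y) ∈ D => hy ?_) _
    have h1 : dist y x < r := h.1
    have h2 : dist x x₀ < r := h.2
    rw [mem_ball]
    linarith [dist_triangle y x x₀]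

/-- Multiplication by `a ∈ M^{2,2}` followed by the Riesz potential of order one acts on
`M^{q,1}(B_1)`, with norm at most a constant times the norm of `a`. The exponent `1` is subcritical
(it is less than `q / (q - 1)`), so that Hölder's inequality with respect to `a u dy` suffices near
the diagonal and no maximal function is needed. -/
theorem exists_morreyBound_rieszOp {n : ℕ} (hn : 2 ≤ n) {q : ℝ} (hq : 2 ≤ q) :
    ∃ C : ℝ≥0∞, C ≠ ⊤ ∧ ∀ (a u : EuclideanSpace ℝ (Fin n) → ℝ≥0∞) (Na Nu : ℝ≥0∞),
      Measurable a → Measurable u → MorreyBound 2 ((n : ℝ) - 2) a Na →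
      MorreyBound q ((n : ℝ) - 1) u Nu →
      MorreyBound q ((n : ℝ) - 1) (rieszOp a u) (C * (Na * Nu)) := by
  have hn' : (2 : ℝ) ≤ n := by exact_mod_cast hn
  have hq0 : 0 < q := by linarith
  have hq1 : 0 < q - 1 := by linarith
  set m : ℝ := (n : ℝ) - 1 - 1 / q with hm
  -- The kernel is split as `c / q + b (q - 1) / q = n - 1` with `c < n` and `b < m`.
  set c : ℝ := n - 1 / (2 * q) with hc
  set b : ℝ := n - 1 - (1 - 1 / (2 * q)) / (q - 1) with hb
  have hqi : 1 / (2 * q) ≤ 1 / 4 := one_div_le_one_div_of_le (by norm_num) (by linarith)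
  have hqi0 : 0 < 1 / (2 * q) := by positivity
  have hc0 : 0 < c := by linarith
  have hcn : c < n := by linarith
  have hb0 : 0 < b := by
    have : (1 - 1 / (2 * q)) / (q - 1) < 1 := by rw [div_lt_one hq1]; linarith
    linarith
  have hbm : b < m := by
    have : 1 / q < (1 - 1 / (2 * q)) / (q - 1) := by
      rw [lt_div_iff₀ hq1]
      have : 1 / q * (q - 1) = 1 - 2 * (1 / (2 * q)) := by field_simp
      linarith
    linarith
  have hsplit : c * (1 / q) + b * ((q - 1) / q) = (n : ℝ) - 1 := by
    rw [hc, hb]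
    field_simp
    ring
  have hmn : m < (n : ℝ) - 1 := by
    have : 0 < 1 / q := by positivity
    linarith
  obtain ⟨C₁, hC₁, H₁⟩ := exists_lintegral_powKernel_ball_le (n := n) hb0 hbm
  obtain ⟨C₂, hC₂, H₂⟩ := exists_lintegral_powKernel_ball_le (n := n) hc0 hcn
  obtain ⟨C₃, hC₃, H₃⟩ :=
    exists_lintegral_powKernel_compl_ball_le (n := n) (by linarith : (0 : ℝ) < n - 1) hmn
  set V := unitBallVol n with hV
  have hVt : V ≠ ⊤ := unitBallVol_ne_top n
  have hθ : 0 ≤ 1 / 2 - 1 / q := by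
    rw [sub_nonneg]; exact one_div_le_one_div_of_le two_pos hq
  set T : ℝ≥0∞ :=
    2 ^ (q - 1) * (C₁ ^ (q - 1) * (C₂ * V * ENNReal.ofReal (2 ^ m)) + C₃ ^ q * V) with hT
  have hTt : T ≠ ⊤ := by
    have h2 : (2 : ℝ≥0∞) ^ (q - 1) ≠ ⊤ := ENNReal.rpow_ne_top_of_nonneg hq1.le (by simp)
    have h3 : C₁ ^ (q - 1) ≠ ⊤ := ENNReal.rpow_ne_top_of_nonneg hq1.le hC₁
    have h4 : C₃ ^ q ≠ ⊤ := ENNReal.rpow_ne_top_of_nonneg hq0.le hC₃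
    finiteness
  refine ⟨T ^ (1 / q) * V ^ (1 / 2 - 1 / q),
    ENNReal.mul_ne_top (ENNReal.rpow_ne_top_of_nonneg (by positivity) hTt)
      (ENNReal.rpow_ne_top_of_nonneg hθ hVt), ?_⟩
  intro a u Na Nu ha hu hA hU x₀ hx₀ r hr
  set M := V ^ (1 / 2 - 1 / q) * (Na * Nu) with hM
  set ν := (volume.restrict (ball (0 : EuclideanSpace ℝ (Fin n)) 1)).withDensity
    (fun y => a y * u y) with hνdef
  have hν : ∀ x ∈ ball (0 : EuclideanSpace ℝ (Fin n)) 1, ∀ ρ : ℝ, 0 < ρ →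
      ν (ball x ρ) ≤ M * ENNReal.ofReal (ρ ^ m) := by
    intro x hx ρ hρ
    rw [hνdef, withDensity_apply _ measurableSet_ball, Measure.restrict_restrict measurableSet_ball]
    exact lintegral_mul_le_of_morreyBound hq ha hu hA hU hx hρ
  have hS : ∀ x, rieszOp a u x = ∫⁻ y, powKernel ((n : ℝ) - 1) (x - y) ∂ν := by
    intro x
    have hk : Measurable fun y => powKernel ((n : ℝ) - 1) (x - y) :=
      (measurable_powKernel _).comp (measurable_const.sub measurable_id)
    have h := lintegral_withDensity_eq_lintegral_mul (volume.restrict (ball 0 1)) (ha.mul hu) hk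
    exact (lintegral_congr fun y => mul_comm _ _).trans h.symm
  have hpt : ∀ x ∈ ball x₀ r ∩ ball 0 1, rieszOp a u x ^ q ≤
      2 ^ (q - 1) * ((∫⁻ y in ball x r, powKernel c (x - y) ∂ν) *
        (C₁ * M * ENNReal.ofReal (r ^ (m - b))) ^ (q - 1) +
        (C₃ * M * ENNReal.ofReal (r ^ (m - ((n : ℝ) - 1)))) ^ q) := by
    rintro x ⟨-, hx⟩
    rw [hS x, ← lintegral_add_compl _ (measurableSet_ball (x := x) (ε := r))]
    refine (ENNReal.rpow_add_le_mul_rpow_add_rpow _ _ (by linarith)).trans ?_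
    refine mul_le_mul' le_rfl
      (add_le_add ?_ (ENNReal.rpow_le_rpow (H₃ ν x M (hν x hx) r hr) hq0.le))
    have hmeas : ∀ t : ℝ, AEMeasurable (fun y => powKernel t (x - y)) (ν.restrict (ball x r)) :=
      fun t => ((measurable_powKernel _).comp (measurable_const.sub measurable_id)).aemeasurable
    have hh := ENNReal.lintegral_mul_norm_pow_le (hmeas c) (hmeas b)
      (by positivity : (0 : ℝ) ≤ 1 / q) (by positivity : (0 : ℝ) ≤ (q - 1) / q)
      (by field_simp; ring)
    simp_rw [powKernel_mul_rpow (by linarith : (0 : ℝ) < n - 1) hc0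
      (by positivity : (0 : ℝ) < 1 / q) (by positivity : (0 : ℝ) ≤ (q - 1) / q) hsplit]
    refine (ENNReal.rpow_le_rpow hh hq0.le).trans ?_
    rw [ENNReal.mul_rpow_of_nonneg _ _ hq0.le, ← ENNReal.rpow_mul, ← ENNReal.rpow_mul,
      one_div_mul_cancel hq0.ne', div_mul_cancel₀ _ hq0.ne', ENNReal.rpow_one]
    exact mul_le_mul' le_rfl (ENNReal.rpow_le_rpow (H₁ ν x M (hν x hx) r hr) hq1.le)
  have hnear : ∫⁻ x in ball x₀ r, ∫⁻ y in ball x r, powKernel c (x - y) ∂ν ≤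
      C₂ * V * ENNReal.ofReal (r ^ ((n : ℝ) - c)) * (M * ENNReal.ofReal ((2 * r) ^ m)) := by
    refine (lintegral_lintegral_powKernel_near_le ν
      (fun y => H₂ volume y V (fun ρ hρ => (volume_ball_eq y hρ).le) r hr) x₀).trans ?_
    exact mul_le_mul' le_rfl (hν x₀ hx₀ _ (by linarith))
  have hKm : Measurable fun x => ∫⁻ y in ball x r, powKernel c (x - y) ∂ν := by
    have : ∀ x, ∫⁻ y in ball x r, powKernel c (x - y) ∂ν = ∫⁻ y, ({z :
        EuclideanSpace ℝ (Fin n) × EuclideanSpace ℝ (Fin n) | dist z.2 z.1 < r}.indicator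
          (fun z => powKernel c (z.1 - z.2))) (x, y) ∂ν := by
      intro x
      rw [← lintegral_indicator measurableSet_ball]
      rfl
    simp_rw [this]
    refine Measurable.lintegral_prod_right (f := _) ?_
    exact ((measurable_powKernel c).comp (measurable_fst.sub measurable_snd)).indicator
      (isOpen_lt (continuous_snd.dist continuous_fst) continuous_const).measurableSet
  calc ∫⁻ x in ball x₀ r ∩ ball 0 1, rieszOp a u x ^ q
      ≤ ∫⁻ x in ball x₀ r ∩ ball 0 1, 2 ^ (q - 1) *
        ((∫⁻ y in ball x r, powKernel c (x - y) ∂ν) *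
        (C₁ * M * ENNReal.ofReal (r ^ (m - b))) ^ (q - 1) +
        (C₃ * M * ENNReal.ofReal (r ^ (m - ((n : ℝ) - 1)))) ^ q) :=
        setLIntegral_mono (((hKm.mul_const _).add_const _).const_mul _) hpt
    _ ≤ ∫⁻ x in ball x₀ r, 2 ^ (q - 1) *
        ((∫⁻ y in ball x r, powKernel c (x - y) ∂ν) *
        (C₁ * M * ENNReal.ofReal (r ^ (m - b))) ^ (q - 1) +
        (C₃ * M * ENNReal.ofReal (r ^ (m - ((n : ℝ) - 1)))) ^ q) :=
        lintegral_mono_set Set.inter_subset_left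
    _ = 2 ^ (q - 1) * ((∫⁻ x in ball x₀ r, ∫⁻ y in ball x r, powKernel c (x - y) ∂ν) *
        (C₁ * M * ENNReal.ofReal (r ^ (m - b))) ^ (q - 1) +
        (C₃ * M * ENNReal.ofReal (r ^ (m - ((n : ℝ) - 1)))) ^ q * volume (ball x₀ r)) := by
        rw [lintegral_const_mul _ ((hKm.mul_const _).add_const _),
          lintegral_add_right _ measurable_const, lintegral_mul_const _ hKm, setLIntegral_const]
    _ ≤ 2 ^ (q - 1) * ((C₂ * V * ENNReal.ofReal (r ^ ((n : ℝ) - c)) *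
          (M * ENNReal.ofReal ((2 * r) ^ m))) *
        (C₁ * M * ENNReal.ofReal (r ^ (m - b))) ^ (q - 1) +
        (C₃ * M * ENNReal.ofReal (r ^ (m - ((n : ℝ) - 1)))) ^ q *
          (V * ENNReal.ofReal (r ^ (n : ℝ)))) := by
        rw [volume_ball_eq x₀ hr]
        gcongr
    _ = T * M ^ q * ENNReal.ofReal (r ^ ((n : ℝ) - 1)) := by
        have hMq : M ^ q = M * M ^ (q - 1) := by
          have := ENNReal.rpow_add_of_nonneg (x := M) 1 (q - 1) zero_le_one hq1.le
          rwa [add_sub_cancel, ENNReal.rpow_one] at this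
        have e1 : ENNReal.ofReal (r ^ ((n : ℝ) - 1)) = ENNReal.ofReal (r ^ ((n : ℝ) - c)) *
            ENNReal.ofReal (r ^ m) * ENNReal.ofReal (r ^ (m - b)) ^ (q - 1) := by
          rw [ENNReal.ofReal_rpow_of_nonneg (by positivity) hq1.le, ← Real.rpow_mul hr.le,
            ← ENNReal.ofReal_mul (by positivity), ← ENNReal.ofReal_mul (by positivity),
            ← Real.rpow_add hr, ← Real.rpow_add hr]
          congr 2
          rw [hm, hb, hc]
          field_simp
          ring
        have e2 : ENNReal.ofReal (r ^ ((n : ℝ) - 1)) =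
            ENNReal.ofReal (r ^ (m - ((n : ℝ) - 1))) ^ q * ENNReal.ofReal (r ^ (n : ℝ)) := by
          rw [ENNReal.ofReal_rpow_of_nonneg (by positivity) hq0.le, ← Real.rpow_mul hr.le,
            ← ENNReal.ofReal_mul (by positivity), ← Real.rpow_add hr]
          congr 2
          rw [hm]
          field_simp
          ring
        rw [hT, mul_assoc _ (M ^ q), mul_assoc (2 ^ (q - 1)), add_mul,
          ENNReal.mul_rpow_of_nonneg _ _ hq1.le,
          ENNReal.mul_rpow_of_nonneg _ _ hq1.le, ENNReal.mul_rpow_of_nonneg _ _ hq0.le,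
          ENNReal.mul_rpow_of_nonneg _ _ hq0.le, Real.mul_rpow two_pos.le hr.le,
          ENNReal.ofReal_mul (by positivity)]
        congr 2
        · rw [hMq, e1]; ring
        · rw [e2]; ring
    _ = (T ^ (1 / q) * V ^ (1 / 2 - 1 / q) * (Na * Nu)) ^ q *
          ENNReal.ofReal (r ^ ((n : ℝ) - 1)) := by
        rw [mul_assoc (T ^ (1 / q)), ← hM,
          ENNReal.mul_rpow_of_nonneg (T ^ (1 / q)) M hq0.le, ← ENNReal.rpow_mul T,
          one_div_mul_cancel hq0.ne', ENNReal.rpow_one]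

/-! ### Domination by the Neumann series -/

theorem rieszOp_mono_ae {n : ℕ} (a : EuclideanSpace ℝ (Fin n) → ℝ≥0∞)
    {u v : EuclideanSpace ℝ (Fin n) → ℝ≥0∞} (h : u ≤ᵐ[volume.restrict (ball 0 1)] v)
    (x : EuclideanSpace ℝ (Fin n)) : rieszOp a u x ≤ rieszOp a v x := by
  refine lintegral_mono_ae ?_
  filter_upwards [h] with y hy
  gcongr

theorem rieszOp_add {n : ℕ} {a u : EuclideanSpace ℝ (Fin n) → ℝ≥0∞}
    (v : EuclideanSpace ℝ (Fin n) → ℝ≥0∞) (ha : Measurable a) (hu : Measurable u)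
    (x : EuclideanSpace ℝ (Fin n)) :
    rieszOp a (fun y => u y + v y) x = rieszOp a u x + rieszOp a v x := by
  unfold rieszOp
  rw [← lintegral_add_left]
  · refine lintegral_congr fun y => ?_
    ring
  · exact ((measurable_powKernel _).comp (measurable_const.sub measurable_id)).mul (ha.mul hu)

/-- The iterates `V₀ = 0`, `V_{k + 1} = S_a V_k + g`, that is, the partial sums of the Neumann
series `∑ j, S_a ^ j g`. -/
noncomputable def neumannSum {n : ℕ} (a g : EuclideanSpace ℝ (Fin n) → ℝ≥0∞) :
    ℕ → EuclideanSpace ℝ (Fin n) → ℝ≥0∞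
  | 0 => fun _ => 0
  | k + 1 => fun x => rieszOp a (neumannSum a g k) x + g x

theorem measurable_neumannSum {n : ℕ} {a g : EuclideanSpace ℝ (Fin n) → ℝ≥0∞}
    (ha : Measurable a) (hg : Measurable g) (k : ℕ) : Measurable (neumannSum a g k) := by
  induction k with
  | zero => exact measurable_const
  | succ k ih => exact (measurable_rieszOp ha ih).add hg

theorem monotone_neumannSum {n : ℕ} (a g : EuclideanSpace ℝ (Fin n) → ℝ≥0∞) :
    Monotone (neumannSum a g) := by
  refine monotone_nat_of_le_succ fun k => ?_
  induction k with
  | zero => exact fun x => zero_le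
  | succ k ih =>
    exact fun x => add_le_add (rieszOp_mono_ae a (Filter.Eventually.of_forall ih) x) le_rfl

theorem measurable_iterate_rieszOp {n : ℕ} {a v : EuclideanSpace ℝ (Fin n) → ℝ≥0∞}
    (ha : Measurable a) (hv : Measurable v) (k : ℕ) : Measurable ((rieszOp a)^[k] v) := by
  induction k with
  | zero => exact hv
  | succ k ih =>
    rw [Function.iterate_succ_apply']
    exact measurable_rieszOp ha ih

theorem le_iterate_add_neumannSum {n : ℕ} {a g v : EuclideanSpace ℝ (Fin n) → ℝ≥0∞}
    (ha : Measurable a) (hv : Measurable v)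
    (h : ∀ᵐ x ∂volume.restrict (ball 0 1), v x ≤ rieszOp a v x + g x) (k : ℕ) :
    ∀ᵐ x ∂volume.restrict (ball 0 1), v x ≤ (rieszOp a)^[k] v x + neumannSum a g k x := by
  induction k with
  | zero => simp [neumannSum]
  | succ k ih =>
    filter_upwards [h] with x hx
    rw [Function.iterate_succ_apply', neumannSum, ← add_assoc,
      ← rieszOp_add _ ha (measurable_iterate_rieszOp ha hv k)]
    exact hx.trans (add_le_add (rieszOp_mono_ae a ih x) le_rfl)

theorem MorreyBound.iSup {n : ℕ} {q m : ℝ} (hq : 0 < q)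
    {V : ℕ → EuclideanSpace ℝ (Fin n) → ℝ≥0∞} {N : ℝ≥0∞} (hm : ∀ k, Measurable (V k))
    (hmono : Monotone V) (h : ∀ k, MorreyBound q m (V k) N) :
    MorreyBound q m (fun x => ⨆ k, V k x) N := by
  intro x hx r hr
  have e : ∀ y, (⨆ k, V k y) ^ q = ⨆ k, V k y ^ q := fun y =>
    (ENNReal.orderIsoRpow q hq).map_iSup fun k => V k y
  simp_rw [e]
  rw [lintegral_iSup (fun k => (hm k).pow_const q)
    fun i j hij y => ENNReal.rpow_le_rpow (hmono hij y) hq.le]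
  exact iSup_le fun k => h k x hx r hr

/-- Gain of integrability for a subsolution `v ≤ S_a v + g`: if `S_a` halves both the norm of
`M^{2,1}`, which contains `v`, and that of `M^{p,1}`, which contains `g`, then `v` is dominated by
the Neumann series of `g`, and so it lies in `M^{p,1}`. -/
theorem MorreyBound.of_le_rieszOp_add {n : ℕ} {p : ℝ} (hp : 1 ≤ p)
    {a g v : EuclideanSpace ℝ (Fin n) → ℝ≥0∞} {Nv Ng : ℝ≥0∞}
    (ha : Measurable a) (hg : Measurable g) (hv : Measurable v)
    (h2 : ∀ u N, Measurable u → MorreyBound 2 ((n : ℝ) - 1) u N →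
      MorreyBound 2 ((n : ℝ) - 1) (rieszOp a u) (2⁻¹ * N))
    (hp' : ∀ u N, Measurable u → MorreyBound p ((n : ℝ) - 1) u N →
      MorreyBound p ((n : ℝ) - 1) (rieszOp a u) (2⁻¹ * N))
    (hNv : MorreyBound 2 ((n : ℝ) - 1) v Nv) (hNvt : Nv ≠ ⊤)
    (hNg : MorreyBound p ((n : ℝ) - 1) g Ng)
    (h : ∀ᵐ x ∂volume.restrict (ball 0 1), v x ≤ rieszOp a v x + g x) :
    ∃ V : EuclideanSpace ℝ (Fin n) → ℝ≥0∞, MorreyBound p ((n : ℝ) - 1) V (2 * Ng) ∧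
      ∀ᵐ x ∂volume.restrict (ball 0 1), v x ≤ V x := by
  have hVm := measurable_neumannSum ha hg
  have hVb : ∀ k, MorreyBound p ((n : ℝ) - 1) (neumannSum a g k) (2 * Ng) := by
    intro k
    induction k with
    | zero =>
      intro x _ r _
      simp [neumannSum, ENNReal.zero_rpow_of_pos (by linarith : 0 < p)]
    | succ k ih =>
      have := (hp' _ _ (hVm k) ih).add hp hNg (measurable_rieszOp ha (hVm k)) hg
      rwa [← mul_assoc, ENNReal.inv_mul_cancel two_ne_zero ENNReal.ofNat_ne_top, one_mul,
        ← two_mul] at this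
  refine ⟨fun x => ⨆ k, neumannSum a g k x,
    MorreyBound.iSup (by linarith) hVm (monotone_neumannSum a g) hVb, ?_⟩
  set V : EuclideanSpace ℝ (Fin n) → ℝ≥0∞ := fun x => ⨆ k, neumannSum a g k x with hVdef
  have hVmeas : Measurable V := Measurable.iSup hVm
  have hit : ∀ k, MorreyBound 2 ((n : ℝ) - 1) ((rieszOp a)^[k] v) ((2⁻¹) ^ k * Nv) := by
    intro k
    induction k with
    | zero => simpa using hNv
    | succ k ih =>
      rw [Function.iterate_succ_apply', pow_succ', mul_assoc]
      exact h2 _ _ (measurable_iterate_rieszOp ha hv k) ih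
  -- The excess of `v` over the series is at most `S_a ^ k v`, which tends to `0` in `L²`.
  have hk : ∀ k : ℕ, ∫⁻ x in ball 0 1, (v x - V x) ^ (2 : ℝ) ≤ ((2⁻¹) ^ k * Nv) ^ (2 : ℝ) := by
    intro k
    have h1 := hit k 0 (by simp) 1 one_pos
    rw [Set.inter_self, Real.one_rpow, ENNReal.ofReal_one, mul_one] at h1
    refine le_trans (lintegral_mono_ae ?_) h1
    filter_upwards [le_iterate_add_neumannSum ha hv h k] with x hx
    refine ENNReal.rpow_le_rpow ?_ (by norm_num)
    rw [tsub_le_iff_right]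
    exact hx.trans (add_le_add le_rfl (le_iSup (fun k => neumannSum a g k x) k))
  have hlim : Filter.Tendsto (fun k : ℕ => ((2⁻¹ : ℝ≥0∞) ^ k * Nv) ^ (2 : ℝ)) Filter.atTop
      (nhds 0) := by
    have h0 : Filter.Tendsto (fun k : ℕ => (2⁻¹ : ℝ≥0∞) ^ k * Nv) Filter.atTop (nhds 0) := by
      have := ENNReal.Tendsto.mul_const (b := Nv)
        (ENNReal.tendsto_pow_atTop_nhds_zero_of_lt_one (r := 2⁻¹) (by norm_num)) (Or.inr hNvt)
      rwa [zero_mul] at this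
    have := h0.ennrpow_const 2
    rwa [ENNReal.zero_rpow_of_pos (by norm_num)] at this
  have hzero : ∫⁻ x in ball 0 1, (v x - V x) ^ (2 : ℝ) = 0 :=
    le_antisymm (ge_of_tendsto' hlim hk) zero_le
  replace hzero := (lintegral_eq_zero_iff (f := fun x => (v x - V x) ^ (2 : ℝ))
    ((hv.sub hVmeas).pow_const _)).1 hzero
  filter_upwards [hzero] with x hx
  have hx' : (v x - V x) ^ (2 : ℝ) = 0 := hx
  rw [ENNReal.rpow_eq_zero_iff_of_pos (by norm_num)] at hx'
  exact tsub_eq_zero_iff_le.1 hx'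

/-! ### The regularised fundamental solution -/

/-- A smooth function of `s = |z| ^ 2` that is `|z| ^ (-n)` for `|z| ≥ 1` and vanishes near `0`. The
field `z ↦ radialProfile n (|z| ^ 2) z` is, up to a constant factor, a regularisation of the
gradient of the fundamental solution of the Laplacian. -/
noncomputable def radialProfile (n : ℕ) (s : ℝ) : ℝ :=
  Real.smoothTransition (2 * s - 1) * s ^ (-((n : ℝ) / 2))

/-- The divergence of `z ↦ radialProfile n (|z| ^ 2) z`, as a function of `s = |z| ^ 2`. -/
noncomputable def radialDiv (n : ℕ) (s : ℝ) : ℝ :=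
  n * radialProfile n s + 2 * s * deriv (radialProfile n) s

theorem contDiff_radialProfile (n : ℕ) : ContDiff ℝ ∞ (radialProfile n) := by
  rw [contDiff_iff_contDiffAt]
  intro s
  by_cases hs : s < 1 / 2
  · have : radialProfile n =ᶠ[nhds s] fun _ => 0 := by
      filter_upwards [Iio_mem_nhds hs] with y hy
      have hy' : y < 1 / 2 := hy
      rw [radialProfile, Real.smoothTransition.zero_of_nonpos (by linarith), zero_mul]
    exact contDiffAt_const.congr_of_eventuallyEq this
  · have hs0 : s ≠ 0 := by linarith [not_lt.1 hs]
    have h1 : ContDiffAt ℝ ∞ (fun s : ℝ => Real.smoothTransition (2 * s - 1)) s :=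
      (Real.smoothTransition.contDiff.comp
        ((contDiff_const.mul contDiff_id).sub contDiff_const)).contDiffAt
    exact h1.mul (Real.contDiffAt_rpow_const_of_ne hs0)

theorem radialProfile_nonneg (n : ℕ) {s : ℝ} (hs : 0 ≤ s) : 0 ≤ radialProfile n s :=
  mul_nonneg (Real.smoothTransition.nonneg _) (by positivity)

theorem radialProfile_le (n : ℕ) {s : ℝ} (hs : 0 ≤ s) :
    radialProfile n s ≤ s ^ (-((n : ℝ) / 2)) :=
  mul_le_of_le_one_left (by positivity) (Real.smoothTransition.le_one _)

theorem radialDiv_eq (n : ℕ) {s : ℝ} (hs : 0 < s) :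
    radialDiv n s = 4 * s ^ (1 - (n : ℝ) / 2) * deriv Real.smoothTransition (2 * s - 1) := by
  have h1 : HasDerivAt (fun s : ℝ => Real.smoothTransition (2 * s - 1))
      (deriv Real.smoothTransition (2 * s - 1) * 2) s := by
    have hT : HasDerivAt Real.smoothTransition (deriv Real.smoothTransition (2 * s - 1))
        (2 * s - 1) :=
      ((Real.smoothTransition.contDiff (n := 1)).differentiable one_ne_zero _).hasDerivAt
    have hl : HasDerivAt (fun s : ℝ => 2 * s - 1) 2 s := by
      simpa using ((hasDerivAt_id s).const_mul 2).sub_const 1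
    exact hT.comp s hl
  have h2 := Real.hasDerivAt_rpow_const (x := s) (p := -((n : ℝ) / 2)) (Or.inl hs.ne')
  have h3 : deriv (radialProfile n) s = _ := (h1.mul h2).deriv
  rw [radialDiv, h3, radialProfile, Real.rpow_sub_one hs.ne', sub_eq_add_neg 1 ((n : ℝ) / 2),
    Real.rpow_add hs, Real.rpow_one]
  field_simp
  ring

theorem deriv_smoothTransition_eq_zero {s : ℝ} (hs : 1 < s) :
    deriv Real.smoothTransition s = 0 := by
  have : Real.smoothTransition =ᶠ[nhds s] fun _ => 1 := by
    filter_upwards [Ioi_mem_nhds hs] with y hy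
    exact Real.smoothTransition.one_of_one_le (le_of_lt hy)
  rw [this.deriv_eq, deriv_const]

theorem radialDiv_eq_zero (n : ℕ) {s : ℝ} (hs : 1 < s) : radialDiv n s = 0 := by
  rw [radialDiv_eq n (by linarith), deriv_smoothTransition_eq_zero (by linarith), mul_zero]

theorem radialDiv_nonneg (n : ℕ) {s : ℝ} (hs : 0 ≤ s) : 0 ≤ radialDiv n s := by
  rcases hs.eq_or_lt with rfl | hs
  · simpa [radialDiv] using mul_nonneg n.cast_nonneg (radialProfile_nonneg n le_rfl)
  · rw [radialDiv_eq n hs]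
    have := Real.smoothTransition.monotone.deriv_nonneg (x := 2 * s - 1)
    positivity

theorem exists_radialDiv_ne_zero (n : ℕ) : ∃ s : ℝ, 0 < s ∧ radialDiv n s ≠ 0 := by
  obtain ⟨c, hc, h⟩ := exists_deriv_eq_slope Real.smoothTransition zero_lt_one
    Real.smoothTransition.continuous.continuousOn
    ((Real.smoothTransition.contDiff (n := 1)).differentiable one_ne_zero).differentiableOn
  have hs : 0 < (c + 1) / 2 := by linarith [hc.1]
  refine ⟨(c + 1) / 2, hs, ?_⟩
  rw [radialDiv_eq n hs, show 2 * ((c + 1) / 2) - 1 = c by ring, h,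
    Real.smoothTransition.one, Real.smoothTransition.zero]
  have := Real.rpow_pos_of_pos hs (1 - (n : ℝ) / 2)
  norm_num
  exact this.ne'

theorem continuous_radialDiv (n : ℕ) : Continuous (radialDiv n) := by
  have h1 := (contDiff_radialProfile n).continuous
  have h2 := (contDiff_radialProfile n).continuous_deriv (by simp)
  unfold radialDiv
  fun_prop

theorem radialProfile_scaled_mul_norm_le {n : ℕ} {t : ℝ} (ht : 0 < t)
    (z : EuclideanSpace ℝ (Fin n)) :
    t ^ n * radialProfile n (t ^ 2 * ‖z‖ ^ 2) * ‖z‖ ≤ ‖z‖ ^ (-((n : ℝ) - 1)) := by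
  rcases eq_or_ne z 0 with rfl | hz
  · rw [norm_zero, mul_zero]
    positivity
  have hz' : 0 < ‖z‖ := norm_pos_iff.2 hz
  have h := radialProfile_le n (s := t ^ 2 * ‖z‖ ^ 2) (by positivity)
  have e : (t ^ 2 * ‖z‖ ^ 2) ^ (-((n : ℝ) / 2)) = (t ^ n)⁻¹ * (‖z‖ ^ n)⁻¹ := by
    rw [← mul_pow, Real.rpow_neg (by positivity), ← Real.rpow_natCast (t * ‖z‖) 2,
      ← Real.rpow_mul (by positivity), ← mul_inv, ← mul_pow, ← Real.rpow_natCast (t * ‖z‖) n]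
    congr 2
    push_cast
    ring
  rw [e] at h
  calc t ^ n * radialProfile n (t ^ 2 * ‖z‖ ^ 2) * ‖z‖
      ≤ t ^ n * ((t ^ n)⁻¹ * (‖z‖ ^ n)⁻¹) * ‖z‖ := by gcongr
    _ = (‖z‖ ^ n)⁻¹ * ‖z‖ := by field_simp
    _ = ‖z‖ ^ (-((n : ℝ) - 1)) := by
        rw [neg_sub, sub_eq_add_neg, Real.rpow_add hz', Real.rpow_one, Real.rpow_neg hz'.le,
          Real.rpow_natCast, mul_comm]

theorem continuous_radialDiv_norm (n : ℕ) (t : ℝ) :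
    Continuous fun z : EuclideanSpace ℝ (Fin n) => radialDiv n (t ^ 2 * ‖z‖ ^ 2) :=
  (continuous_radialDiv n).comp (by fun_prop)

theorem integral_radialDiv_pos {n : ℕ} (hn : 1 ≤ n) :
    0 < ∫ z : EuclideanSpace ℝ (Fin n), radialDiv n (‖z‖ ^ 2) := by
  have hc : Continuous fun z : EuclideanSpace ℝ (Fin n) => radialDiv n (‖z‖ ^ 2) := by
    simpa using continuous_radialDiv_norm n 1
  obtain ⟨s, hs, hne⟩ := exists_radialDiv_ne_zero n
  refine hc.integral_pos_of_hasCompactSupport_nonneg_nonzero ?_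
    (fun z => radialDiv_nonneg n (by positivity))
    (x := EuclideanSpace.single (⟨0, hn⟩ : Fin n) (Real.sqrt s)) ?_
  · refine HasCompactSupport.intro (isCompact_closedBall (0 : EuclideanSpace ℝ (Fin n)) 1) ?_
    intro z hz
    have : 1 < ‖z‖ := by simpa using hz
    exact radialDiv_eq_zero n (by nlinarith)
  · simpa [Real.sq_sqrt hs.le] using hne

/-- The rescaled divergences form an approximate identity supported in shrinking balls, so the
Lebesgue differentiation theorem applies to them. -/
theorem ae_tendsto_integral_radialDiv {n : ℕ} (hn : 1 ≤ n) {W : Type*} [NormedAddCommGroup W]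
    [NormedSpace ℝ W] [CompleteSpace W] {ψ : EuclideanSpace ℝ (Fin n) → W} (hψ : Integrable ψ) :
    ∀ᵐ x, Filter.Tendsto
      (fun k : ℕ => ∫ y, (((k : ℝ) + 1) ^ n * radialDiv n (((k : ℝ) + 1) ^ 2 * ‖y - x‖ ^ 2)) • ψ y)
      Filter.atTop (nhds ((∫ z : EuclideanSpace ℝ (Fin n), radialDiv n (‖z‖ ^ 2)) • ψ x)) := by
  set c := ∫ z : EuclideanSpace ℝ (Fin n), radialDiv n (‖z‖ ^ 2) with hcdef
  have hc : 0 < c := integral_radialDiv_pos hn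
  obtain ⟨K, hK⟩ : ∃ K, ∀ s : ℝ, 0 ≤ s → |radialDiv n s| ≤ K := by
    obtain ⟨K, hK⟩ := (isCompact_Icc (a := (0 : ℝ)) (b := 1)).exists_bound_of_continuousOn
      (continuous_radialDiv n).continuousOn
    refine ⟨K, fun s hs => ?_⟩
    rcases le_or_gt s 1 with h | h
    · exact hK s ⟨hs, h⟩
    · rw [radialDiv_eq_zero n h, abs_zero]
      exact (norm_nonneg _).trans (hK 0 ⟨le_rfl, zero_le_one⟩)
  have hδ : Filter.Tendsto (fun k : ℕ => 1 / ((k : ℝ) + 1)) Filter.atTop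
      (nhdsWithin 0 (Set.Ioi 0)) :=
    tendsto_nhdsWithin_iff.2 ⟨tendsto_one_div_add_atTop_nhds_zero_nat,
      Filter.Eventually.of_forall fun k => Set.mem_Ioi.2 Nat.one_div_pos_of_nat⟩
  filter_upwards [(Besicovitch.vitaliFamily
    (volume : Measure (EuclideanSpace ℝ (Fin n)))).ae_tendsto_average_norm_sub
      hψ.locallyIntegrable] with x hx
  have havg := (hx.comp (Besicovitch.tendsto_filterAt volume x)).comp hδ
  have hvol : ∀ k : ℕ, volume.real (closedBall x (1 / ((k : ℝ) + 1))) =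
      (((k : ℝ) + 1) ^ n)⁻¹ * volume.real (ball (0 : EuclideanSpace ℝ (Fin n)) 1) := by
    intro k
    rw [measureReal_def, Measure.addHaar_closedBall _ _ (by positivity), ENNReal.toReal_mul,
      ENNReal.toReal_ofReal (by positivity)]
    simp [measureReal_def]
  have hω : 0 < volume.real (ball (0 : EuclideanSpace ℝ (Fin n)) 1) :=
    ENNReal.toReal_pos (measure_ball_pos _ _ one_pos).ne' measure_ball_lt_top.ne
  have hlim := tendsto_integral_smul_of_tendsto_average_norm_sub
    (g := fun (k : ℕ) y => c⁻¹ *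
      (((k : ℝ) + 1) ^ n * radialDiv n (((k : ℝ) + 1) ^ 2 * ‖y - x‖ ^ 2)))
    (c⁻¹ * K * volume.real (ball (0 : EuclideanSpace ℝ (Fin n)) 1)) havg
    (Filter.Eventually.of_forall fun k => hψ.integrableOn) ?_ ?_ ?_
  · have := hlim.const_smul c
    refine this.congr fun k => ?_
    rw [← integral_smul]
    refine integral_congr_ae (Filter.Eventually.of_forall fun y => ?_)
    simp only [smul_smul]
    rw [mul_inv_cancel_left₀ hc.ne']
  · refine tendsto_const_nhds.congr fun k => ?_
    have hk : (0 : ℝ) < (k : ℝ) + 1 := by positivity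
    rw [integral_const_mul, integral_const_mul,
      integral_sub_right_eq_self (fun z : EuclideanSpace ℝ (Fin n) =>
        radialDiv n (((k : ℝ) + 1) ^ 2 * ‖z‖ ^ 2)) x]
    have e : ∀ z : EuclideanSpace ℝ (Fin n), radialDiv n (((k : ℝ) + 1) ^ 2 * ‖z‖ ^ 2) =
        radialDiv n (‖((k : ℝ) + 1) • z‖ ^ 2) := by
      intro z
      rw [norm_smul, mul_pow, Real.norm_of_nonneg hk.le]
    simp_rw [e]
    rw [Measure.integral_comp_smul volume
      (fun z : EuclideanSpace ℝ (Fin n) => radialDiv n (‖z‖ ^ 2)), ← hcdef]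
    rw [finrank_euclideanSpace, Fintype.card_fin, smul_eq_mul, abs_of_pos (by positivity)]
    field_simp
  · refine Filter.Eventually.of_forall fun k y hy => ?_
    by_contra hy'
    refine hy ?_
    have hk : (0 : ℝ) < (k : ℝ) + 1 := by positivity
    have h1 : 1 / ((k : ℝ) + 1) < ‖y - x‖ := by
      rw [← dist_eq_norm]; simpa using hy'
    rw [div_lt_iff₀ hk] at h1
    simp only
    rw [radialDiv_eq_zero n (by nlinarith), mul_zero, mul_zero]
  · refine Filter.Eventually.of_forall fun k y => ?_
    have hk : (0 : ℝ) < (k : ℝ) + 1 := by positivity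
    simp only
    rw [hvol, abs_mul, abs_mul, abs_of_pos (inv_pos.2 hc), abs_of_pos (pow_pos hk n)]
    have := hK (((k : ℝ) + 1) ^ 2 * ‖y - x‖ ^ 2) (by positivity)
    calc c⁻¹ * (((k : ℝ) + 1) ^ n * |radialDiv n (((k : ℝ) + 1) ^ 2 * ‖y - x‖ ^ 2)|)
        ≤ c⁻¹ * (((k : ℝ) + 1) ^ n * K) := by gcongr
      _ = _ := by field_simp

/-! ### The pointwise bound for weak solutions -/

/-- The action `∑ β, z_β G_β` of a vector `z ∈ ℝⁿ`, for operators `G_β` that represent the standard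
basis vectors. -/
noncomputable def cliffordSum {n : ℕ} {W : Type*} [NormedAddCommGroup W] [NormedSpace ℝ W]
    (G : Fin n → W →L[ℝ] W) (z : Fin n → ℝ) (v : W) : W :=
  ∑ β, z β • G β v

theorem cliffordSum_self {n : ℕ} {W : Type*} [NormedAddCommGroup W] [NormedSpace ℝ W]
    {G : Fin n → W →L[ℝ] W}
    (hG : ∀ α β v, G α (G β v) + G β (G α v) = if α = β then (-2 : ℝ) • v else 0)
    (z : Fin n → ℝ) (v : W) :
    cliffordSum G z (cliffordSum G z v) = -(∑ β, z β ^ 2) • v := by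
  have h1 : cliffordSum G z (cliffordSum G z v) =
      ∑ β, ∑ α, (z β * z α) • G β (G α v) := by
    simp only [cliffordSum, map_sum, map_smul, Finset.smul_sum, smul_smul]
  have h2 : ∑ β, ∑ α, (z β * z α) • G β (G α v) = ∑ β, ∑ α, (z β * z α) • G α (G β v) := by
    rw [Finset.sum_comm]
    simp only [mul_comm]
  have h3 : (2 : ℝ) • cliffordSum G z (cliffordSum G z v) = (2 : ℝ) • (-(∑ β, z β ^ 2) • v) := by
    calc (2 : ℝ) • cliffordSum G z (cliffordSum G z v)
        = (∑ β, ∑ α, (z β * z α) • G β (G α v)) + ∑ β, ∑ α, (z β * z α) • G α (G β v) := by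
          rw [← h2, ← h1, two_smul]
      _ = ∑ β, ∑ α, (z β * z α) • (G β (G α v) + G α (G β v)) := by
          simp only [smul_add, Finset.sum_add_distrib]
      _ = (2 : ℝ) • (-(∑ β, z β ^ 2) • v) := by
          simp only [hG, smul_ite, smul_zero, Finset.sum_ite_eq, Finset.mem_univ, if_true,
            smul_smul, ← Finset.sum_smul]
          congr 1
          rw [mul_neg, Finset.mul_sum, ← Finset.sum_neg_distrib]
          exact Finset.sum_congr rfl fun β _ => by ring
  exact (smul_right_injective W (two_ne_zero (α := ℝ))) h3

theorem norm_cliffordSum_le {n : ℕ} {W : Type*} [NormedAddCommGroup W] [NormedSpace ℝ W]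
    {G : Fin n → W →L[ℝ] W} (hG : ∀ α v, ‖G α v‖ ≤ ‖v‖) {z : Fin n → ℝ} {R : ℝ}
    (hz : ∀ β, |z β| ≤ R) (v : W) : ‖cliffordSum G z v‖ ≤ n * R * ‖v‖ := by
  calc ‖cliffordSum G z v‖ ≤ ∑ β : Fin n, ‖z β • G β v‖ := norm_sum_le _ _
    _ ≤ ∑ _β : Fin n, R * ‖v‖ := by
        refine Finset.sum_le_sum fun β _ => ?_
        rw [norm_smul]
        exact mul_le_mul (hz β) (hG β v) (norm_nonneg _) ((abs_nonneg _).trans (hz β))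
    _ = n * R * ‖v‖ := by simp [mul_assoc]

/-- The test function `χ(y) z_β κ(z)`, `z = y - x`, where `κ` is the regularisation of `|z| ^ (-n)`
at scale `1 / t`. -/
noncomputable def kernelTest {n : ℕ} (χ : EuclideanSpace ℝ (Fin n) → ℝ) (t : ℝ)
    (x : EuclideanSpace ℝ (Fin n)) (β : Fin n) (y : EuclideanSpace ℝ (Fin n)) : ℝ :=
  χ y * ((y - x) β * (t ^ n * radialProfile n (t ^ 2 * ‖y - x‖ ^ 2)))

theorem contDiff_kernelTest {n : ℕ} {χ : EuclideanSpace ℝ (Fin n) → ℝ} (hχ : ContDiff ℝ ∞ χ)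
    (t : ℝ) (x : EuclideanSpace ℝ (Fin n)) (β : Fin n) : ContDiff ℝ ∞ (kernelTest χ t x β) := by
  have h1 : ContDiff ℝ ∞ fun y : EuclideanSpace ℝ (Fin n) => (y - x) β :=
    (EuclideanSpace.proj β : EuclideanSpace ℝ (Fin n) →L[ℝ] ℝ).contDiff.comp
      (contDiff_id.sub contDiff_const)
  have h2 : ContDiff ℝ ∞ fun y : EuclideanSpace ℝ (Fin n) =>
      radialProfile n (t ^ 2 * ‖y - x‖ ^ 2) :=
    (contDiff_radialProfile n).comp
      (contDiff_const.mul ((contDiff_id.sub contDiff_const).norm_sq ℝ))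
  exact hχ.mul (h1.mul (contDiff_const.mul h2))

theorem fderiv_kernelTest {n : ℕ} {χ : EuclideanSpace ℝ (Fin n) → ℝ} (hχ : ContDiff ℝ ∞ χ)
    (t : ℝ) (x : EuclideanSpace ℝ (Fin n)) (β α : Fin n) (y : EuclideanSpace ℝ (Fin n)) :
    fderiv ℝ (kernelTest χ t x β) y (EuclideanSpace.single α 1) =
      fderiv ℝ χ y (EuclideanSpace.single α 1) *
        ((y - x) β * (t ^ n * radialProfile n (t ^ 2 * ‖y - x‖ ^ 2))) +
      χ y * ((if α = β then 1 else 0) * (t ^ n * radialProfile n (t ^ 2 * ‖y - x‖ ^ 2)) +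
        (y - x) β * (t ^ n * (deriv (radialProfile n) (t ^ 2 * ‖y - x‖ ^ 2) *
          (t ^ 2 * (2 * (y - x) α))))) := by
  have h0 : HasFDerivAt χ (fderiv ℝ χ y) y := (hχ.differentiable (by simp) y).hasFDerivAt
  have hs : HasFDerivAt (fun y : EuclideanSpace ℝ (Fin n) => y - x)
      (ContinuousLinearMap.id ℝ _) y := (hasFDerivAt_id y).sub_const x
  have h1 : HasFDerivAt (fun y : EuclideanSpace ℝ (Fin n) => (y - x) β)
      ((EuclideanSpace.proj β : EuclideanSpace ℝ (Fin n) →L[ℝ] ℝ).comp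
        (ContinuousLinearMap.id ℝ _)) y :=
    (EuclideanSpace.proj β : EuclideanSpace ℝ (Fin n) →L[ℝ] ℝ).hasFDerivAt.comp y hs
  have h2 := hs.norm_sq.const_mul (t ^ 2)
  have hg : HasDerivAt (radialProfile n) (deriv (radialProfile n) (t ^ 2 * ‖y - x‖ ^ 2))
      (t ^ 2 * ‖y - x‖ ^ 2) :=
    ((contDiff_radialProfile n).differentiable (by simp) _).hasDerivAt
  have h3 := (hg.comp_hasFDerivAt y h2).const_mul (t ^ n)
  have h4 : HasFDerivAt (kernelTest χ t x β) _ y := h0.mul (h1.mul h3)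
  rw [h4.fderiv]
  simp [EuclideanSpace.inner_single_right]
  by_cases h : α = β
  · subst h
    simp
    ring
  · simp [h, Ne.symm h]
    ring

/-- Testing with `kernelTest` and contracting with the operators `G_β`: by the Clifford relations
the derivatives of the kernel collapse to its divergence. -/
theorem sum_map_sum_fderiv_kernelTest {n : ℕ} {W : Type*} [NormedAddCommGroup W] [NormedSpace ℝ W]
    {G : Fin n → W →L[ℝ] W}
    (hG : ∀ α β v, G α (G β v) + G β (G α v) = if α = β then (-2 : ℝ) • v else 0)
    {χ : EuclideanSpace ℝ (Fin n) → ℝ} (hχ : ContDiff ℝ ∞ χ) (t : ℝ)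
    (x y : EuclideanSpace ℝ (Fin n)) (v : W) :
    ∑ β, G β (∑ α, fderiv ℝ (kernelTest χ t x β) y (EuclideanSpace.single α 1) • G α v) =
      (t ^ n * radialProfile n (t ^ 2 * ‖y - x‖ ^ 2)) • cliffordSum G (fun β => (y - x) β)
          (cliffordSum G (fun α => fderiv ℝ χ y (EuclideanSpace.single α 1)) v) -
        (t ^ n * radialDiv n (t ^ 2 * ‖y - x‖ ^ 2)) • χ y • v := by
  set K := t ^ n * radialProfile n (t ^ 2 * ‖y - x‖ ^ 2) with hK
  set D := t ^ n * (deriv (radialProfile n) (t ^ 2 * ‖y - x‖ ^ 2) * (t ^ 2 * 2)) with hD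
  set z : Fin n → ℝ := fun β => (y - x) β with hz
  set X := cliffordSum G (fun α => fderiv ℝ χ y (EuclideanSpace.single α 1)) v with hX
  have hGG : ∀ β w, G β (G β w) = -w := by
    intro β w
    have h := hG β β w
    rw [if_pos rfl, ← two_smul ℝ] at h
    refine smul_right_injective W (two_ne_zero (α := ℝ)) ?_
    simpa using h
  have hzz : ∑ β, z β ^ 2 = ‖y - x‖ ^ 2 := (EuclideanSpace.real_norm_sq_eq (y - x)).symm
  have h1 : ∀ β, ∑ α, fderiv ℝ (kernelTest χ t x β) y (EuclideanSpace.single α 1) • G α v =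
      K • z β • X + (χ y * K) • G β v + (χ y * D) • z β • cliffordSum G z v := by
    intro β
    have h2 : ∀ α, fderiv ℝ (kernelTest χ t x β) y (EuclideanSpace.single α 1) • G α v =
        K • z β • fderiv ℝ χ y (EuclideanSpace.single α 1) • G α v +
          (χ y * K) • (if α = β then G α v else 0) + (χ y * D) • z β • z α • G α v := by
      intro α
      rw [fderiv_kernelTest hχ]
      split_ifs with h
      · simp only [smul_smul, ← add_smul]
        congr 1
        simp only [hK, hD, hz]
        ring
      · simp only [smul_smul, smul_zero, add_zero, ← add_smul]
        congr 1
        simp only [hK, hD, hz]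
        ring
    simp only [h2, Finset.sum_add_distrib, ← Finset.smul_sum, Finset.sum_ite_eq', Finset.mem_univ,
      if_true]
    rfl
  have h3 : ∀ w, ∑ β, z β • G β w = cliffordSum G z w := fun w => rfl
  simp only [h1, map_add, map_smul, hGG, Finset.sum_add_distrib, ← Finset.smul_sum, h3,
    cliffordSum_self hG, hzz]
  have h4 : (n : ℝ) * K + D * ‖y - x‖ ^ 2 = t ^ n * radialDiv n (t ^ 2 * ‖y - x‖ ^ 2) := by
    rw [radialDiv, hK, hD]
    ring
  rw [← h4]
  simp only [Finset.sum_const, Finset.card_univ, Fintype.card_fin, ← Nat.cast_smul_eq_nsmul ℝ]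
  module

/-- Pointwise bound for weak solutions of a first-order system of Dirac type: a localised solution
is controlled by the Riesz potential of order one of its data. -/
theorem exists_enorm_le_lintegral_powKernel {n : ℕ} (hn : 1 ≤ n) :
    ∃ C : ℝ≥0∞, C ≠ ⊤ ∧ ∀ (W : Type) [NormedAddCommGroup W] [NormedSpace ℝ W] [CompleteSpace W]
      (G : Fin n → W →L[ℝ] W) (χ : EuclideanSpace ℝ (Fin n) → ℝ) (R : ℝ)
      (f φ : EuclideanSpace ℝ (Fin n) → W),
      (∀ α β v, G α (G β v) + G β (G α v) = if α = β then (-2 : ℝ) • v else 0) →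
      (∀ α v, ‖G α v‖ ≤ ‖v‖) →
      ContDiff ℝ ∞ χ → HasCompactSupport χ → tsupport χ ⊆ ball 0 1 →
      (∀ y α, |fderiv ℝ χ y (EuclideanSpace.single α 1)| ≤ R) →
      IntegrableOn f (ball 0 1) → IntegrableOn φ (ball 0 1) →
      (∀ η : EuclideanSpace ℝ (Fin n) → ℝ, ContDiff ℝ ∞ η → HasCompactSupport η →
        tsupport η ⊆ ball 0 1 →
        -∫ x in ball 0 1, ∑ α, fderiv ℝ η x (EuclideanSpace.single α 1) • G α (φ x) =
          ∫ x in ball 0 1, η x • f x) →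
      ∀ᵐ x ∂volume.restrict (ball 0 1), ‖χ x • φ x‖ₑ ≤ C * ∫⁻ y in ball 0 1,
        powKernel ((n : ℝ) - 1) (x - y) * (‖χ y • f y‖ₑ + ENNReal.ofReal (n * R) * ‖φ y‖ₑ) := by
  have hc := integral_radialDiv_pos hn
  set c := ∫ z : EuclideanSpace ℝ (Fin n), radialDiv n (‖z‖ ^ 2)
  refine ⟨ENNReal.ofReal c⁻¹ * n, by finiteness, ?_⟩
  intro W _ _ _ G χ R f φ hG hG1 hχ hχc hχs hR hf hφ hweak
  have hψ : Integrable ((ball (0 : EuclideanSpace ℝ (Fin n)) 1).indicator fun y => χ y • φ y) := by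
    rw [integrable_indicator_iff measurableSet_ball]
    exact hφ.locallyIntegrable.integrable_smul_left_of_hasCompactSupport hχ.continuous hχc
  set B := ball (0 : EuclideanSpace ℝ (Fin n)) 1
  set H : EuclideanSpace ℝ (Fin n) → ℝ≥0∞ := fun x => ∫⁻ y in B,
        powKernel ((n : ℝ) - 1) (x - y) * (‖χ y • f y‖ₑ + ENNReal.ofReal (n * R) * ‖φ y‖ₑ) with hH
  have hbound : ∀ t : ℝ, 0 < t → ∀ x, ‖∫ y, (t ^ n * radialDiv n (t ^ 2 * ‖y - x‖ ^ 2)) •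
      B.indicator (fun y => χ y • φ y) y‖ₑ ≤ n * H x := by
    intro t ht x
    have hη := fun β => contDiff_kernelTest hχ t x β
    have hηc : ∀ β, HasCompactSupport (kernelTest χ t x β) := fun β => hχc.mul_right
    have hηs : ∀ β, tsupport (kernelTest χ t x β) ⊆ B := fun β =>
      (tsupport_mul_subset_left).trans hχs
    have hi1 : ∀ β, IntegrableOn (fun y => kernelTest χ t x β y • f y) B := fun β =>
      hf.locallyIntegrable.integrable_smul_left_of_hasCompactSupport (hη β).continuous (hηc β)
    have hi2 : ∀ β, IntegrableOn (fun y =>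
        ∑ α, fderiv ℝ (kernelTest χ t x β) y (EuclideanSpace.single α 1) • G α (φ y)) B := by
      intro β
      refine integrable_finsetSum _ fun α _ => ?_
      have hGφ : Integrable (fun y => G α (φ y)) (volume.restrict B) := (G α).integrable_comp hφ
      refine hGφ.locallyIntegrable.integrable_smul_left_of_hasCompactSupport
        (((hη β).continuous_fderiv (by simp)).clm_apply continuous_const) ?_
      exact ((hηc β).fderiv ℝ).comp_left (g := fun L => L (EuclideanSpace.single α 1)) (by simp)
    set κ : EuclideanSpace ℝ (Fin n) → ℝ := fun y =>
      t ^ n * radialProfile n (t ^ 2 * ‖y - x‖ ^ 2) with hκ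
    set X : EuclideanSpace ℝ (Fin n) → W := fun y =>
      cliffordSum G (fun α => fderiv ℝ χ y (EuclideanSpace.single α 1)) (φ y) with hX
    have hφint : IntegrableOn (fun y =>
        (t ^ n * radialDiv n (t ^ 2 * ‖y - x‖ ^ 2)) • χ y • φ y) B := by
      have hcont : Continuous fun y : EuclideanSpace ℝ (Fin n) =>
          t ^ n * radialDiv n (t ^ 2 * ‖y - x‖ ^ 2) :=
        continuous_const.mul ((continuous_radialDiv n).comp (by fun_prop))
      simp only [smul_smul]
      exact hφ.locallyIntegrable.integrable_smul_left_of_hasCompactSupport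
        (hcont.mul hχ.continuous) hχc.mul_left
    have hsum : -∫ y in B, ∑ β, G β (∑ α,
          fderiv ℝ (kernelTest χ t x β) y (EuclideanSpace.single α 1) • G α (φ y)) =
        ∫ y in B, ∑ β, G β (kernelTest χ t x β y • f y) := by
      rw [integral_finsetSum _ fun β _ => (G β).integrable_comp (hi2 β),
        integral_finsetSum _ fun β _ => (G β).integrable_comp (hi1 β), ← Finset.sum_neg_distrib]
      refine Finset.sum_congr rfl fun β _ => ?_
      rw [(G β).integral_comp_comm (hi2 β), (G β).integral_comp_comm (hi1 β), ← map_neg,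
        hweak _ (hη β) (hηc β) (hηs β)]
    have hrhs : ∀ y, ∑ β, G β (kernelTest χ t x β y • f y) =
        κ y • cliffordSum G (fun β => (y - x) β) (χ y • f y) := by
      intro y
      simp only [cliffordSum, map_smul, Finset.smul_sum, smul_smul]
      refine Finset.sum_congr rfl fun β _ => ?_
      congr 1
      simp only [kernelTest, hκ]
      ring
    have hi3 : IntegrableOn (fun y =>
        κ y • cliffordSum G (fun β => (y - x) β) (χ y • f y)) B := by
      simp only [← hrhs]
      exact integrable_finsetSum _ fun β _ => (G β).integrable_comp (hi1 β)
    have hi4 : IntegrableOn (fun y => κ y • cliffordSum G (fun β => (y - x) β) (X y)) B := by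
      have h := (integrable_finsetSum Finset.univ
        fun β _ => (G β).integrable_comp (hi2 β)).add hφint
      refine h.congr (Filter.Eventually.of_forall fun y => ?_)
      simp only [Pi.add_apply]
      rw [sum_map_sum_fderiv_kernelTest hG hχ, sub_add_cancel]
    have hid : ∫ y, (t ^ n * radialDiv n (t ^ 2 * ‖y - x‖ ^ 2)) •
        B.indicator (fun y => χ y • φ y) y =
        ∫ y in B, (κ y • cliffordSum G (fun β => (y - x) β) (χ y • f y) +
          κ y • cliffordSum G (fun β => (y - x) β) (X y)) := by
      have e1 : ∀ y, (t ^ n * radialDiv n (t ^ 2 * ‖y - x‖ ^ 2)) •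
          B.indicator (fun y => χ y • φ y) y =
          B.indicator (fun y => (t ^ n * radialDiv n (t ^ 2 * ‖y - x‖ ^ 2)) • χ y • φ y) y := by
        intro y
        by_cases hy : y ∈ B <;> simp [hy]
      simp only [e1]
      rw [integral_indicator measurableSet_ball, integral_add hi3 hi4]
      simp only [hrhs, sum_map_sum_fderiv_kernelTest hG hχ] at hsum
      rw [integral_sub hi4 hφint] at hsum
      rw [← hsum]
      abel
    rw [hid]
    refine (enorm_integral_le_lintegral_enorm _).trans ?_
    rw [hH, ← lintegral_const_mul' _ _ (ENNReal.natCast_ne_top n)]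
    refine lintegral_mono fun y => ?_
    rw [← smul_add]
    have hκ0 : 0 ≤ κ y := mul_nonneg (by positivity) (radialProfile_nonneg n (by positivity))
    have hz : ∀ β, |(y - x) β| ≤ ‖y - x‖ := fun β => PiLp.norm_apply_le (y - x) β
    have hR0 : 0 ≤ R := (abs_nonneg _).trans (hR 0 ⟨0, hn⟩)
    have hb : ‖κ y • (cliffordSum G (fun β => (y - x) β) (χ y • f y) +
        cliffordSum G (fun β => (y - x) β) (X y))‖ ≤
        n * (‖x - y‖ ^ (-((n : ℝ) - 1)) * (‖χ y • f y‖ + n * R * ‖φ y‖)) := by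
      rw [norm_smul, Real.norm_of_nonneg hκ0]
      have h1 := norm_cliffordSum_le hG1 hz (χ y • f y)
      have h2 := norm_cliffordSum_le hG1 hz (X y)
      have h3 : ‖X y‖ ≤ n * R * ‖φ y‖ := norm_cliffordSum_le hG1 (hR y) (φ y)
      have h4 : κ y * ‖y - x‖ ≤ ‖x - y‖ ^ (-((n : ℝ) - 1)) := by
        rw [norm_sub_rev x y]
        exact radialProfile_scaled_mul_norm_le ht (y - x)
      calc κ y * ‖cliffordSum G (fun β => (y - x) β) (χ y • f y) +
            cliffordSum G (fun β => (y - x) β) (X y)‖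
          ≤ κ y * (n * ‖y - x‖ * ‖χ y • f y‖ + n * ‖y - x‖ * (n * R * ‖φ y‖)) := by
            gcongr
            exact (norm_add_le _ _).trans (add_le_add h1 (h2.trans (by gcongr)))
        _ = n * (κ y * ‖y - x‖ * (‖χ y • f y‖ + n * R * ‖φ y‖)) := by ring
        _ ≤ _ := by gcongr
    rw [← ofReal_norm]
    refine (ENNReal.ofReal_le_ofReal hb).trans (le_of_eq ?_)
    rw [ENNReal.ofReal_mul (by positivity), ENNReal.ofReal_mul (by positivity),
      ENNReal.ofReal_add (by positivity) (by positivity), ENNReal.ofReal_mul (by positivity),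
      ENNReal.ofReal_natCast, ofReal_norm, ofReal_norm, powKernel]
  rw [ae_restrict_iff' measurableSet_ball]
  filter_upwards [ae_tendsto_integral_radialDiv hn hψ] with x hx hxB
  have h1 := le_of_tendsto' hx.enorm fun k : ℕ => hbound ((k : ℝ) + 1) (by positivity) x
  rw [Set.indicator_of_mem hxB, enorm_smul, Real.enorm_of_nonneg hc.le] at h1
  calc ‖χ x • φ x‖ₑ = ENNReal.ofReal c⁻¹ * (ENNReal.ofReal c * ‖χ x • φ x‖ₑ) := by
        rw [← mul_assoc, ← ENNReal.ofReal_mul (by positivity), inv_mul_cancel₀ hc.ne',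
          ENNReal.ofReal_one, one_mul]
    _ ≤ ENNReal.ofReal c⁻¹ * (n * H x) := by gcongr
    _ = _ := by rw [mul_assoc]

/-! ### Higher integrability of subsolutions -/

/-- Higher integrability for functions dominated by a Riesz potential whose coefficient is small in
`M^{2,2}`. -/
theorem exists_lintegral_rpow_le_of_le_lintegral_powKernel {n : ℕ} (hn : 2 ≤ n) {p : ℝ}
    (hp : 2 ≤ p) {C₀ : ℝ≥0∞} (hC₀ : C₀ ≠ ⊤) :
    ∃ ε₀ : ℝ, 0 < ε₀ ∧ ∃ C : ℝ≥0∞, C ≠ ⊤ ∧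
      ∀ (a b v : EuclideanSpace ℝ (Fin n) → ℝ≥0∞) (Na Nb Nv : ℝ≥0∞),
        AEMeasurable a (volume.restrict (ball 0 1)) → AEMeasurable b (volume.restrict (ball 0 1)) →
        AEMeasurable v (volume.restrict (ball 0 1)) →
        MorreyBound 2 ((n : ℝ) - 2) a Na → Na ≤ ENNReal.ofReal ε₀ →
        MorreyBound 2 ((n : ℝ) - 2) b Nb → MorreyBound 2 ((n : ℝ) - 1) v Nv → Nv ≠ ⊤ →
        (∀ᵐ x ∂volume.restrict (ball 0 1), v x ≤
          C₀ * ∫⁻ y in ball 0 1, powKernel ((n : ℝ) - 1) (x - y) * (a y * v y + b y)) →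
        ∫⁻ x in ball 0 1, v x ^ p ≤ (C * Nb) ^ p := by
  have hp0 : 0 < p := by linarith
  obtain ⟨C₂, hC₂, H₂⟩ := exists_morreyBound_rieszOp hn le_rfl
  obtain ⟨C₃, hC₃, H₃⟩ := exists_morreyBound_rieszOp hn hp
  -- With `T = (C₂ + C₃) C₀` and `‖a‖ ≤ 1 / (2 (T + 1))`, the operator `S_{C₀ a}` halves
  -- the norms of `M^{2,1}` and `M^{p,1}`.
  set T : ℝ≥0∞ := (C₂ + C₃) * C₀ with hT
  have hTt : T ≠ ⊤ := by finiteness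
  have hε : 0 < (2 * (T.toReal + 1))⁻¹ := by positivity
  have hTε : T * ENNReal.ofReal (2 * (T.toReal + 1))⁻¹ ≤ 2⁻¹ := by
    nth_rewrite 1 [← ENNReal.ofReal_toReal hTt]
    rw [← ENNReal.ofReal_mul (by positivity), show (2⁻¹ : ℝ≥0∞) = ENNReal.ofReal 2⁻¹ by
      rw [ENNReal.ofReal_inv_of_pos two_pos]; simp]
    refine ENNReal.ofReal_le_ofReal ?_
    have : 0 ≤ T.toReal := ENNReal.toReal_nonneg
    rw [mul_inv, ← mul_assoc, mul_comm _ (2⁻¹ : ℝ), mul_assoc]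
    refine mul_le_of_le_one_right (by norm_num) ?_
    rw [← div_eq_mul_inv, div_le_one (by positivity)]
    linarith
  refine ⟨_, hε, 2 * (C₃ * (C₀ * unitBallVol n ^ (1 / p))), ?_, ?_⟩
  · have : unitBallVol n ^ (1 / p) ≠ ⊤ :=
      ENNReal.rpow_ne_top_of_nonneg (by positivity) (unitBallVol_ne_top n)
    finiteness
  intro a b v Na Nb Nv ha hb hv hA hNa hB hV hNv h
  set a' : EuclideanSpace ℝ (Fin n) → ℝ≥0∞ := fun x => C₀ * ha.mk a x with ha'
  set b' : EuclideanSpace ℝ (Fin n) → ℝ≥0∞ := fun x => C₀ * hb.mk b x with hb'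
  have ham : Measurable a' := ha.measurable_mk.const_mul _
  have hbm : Measurable b' := hb.measurable_mk.const_mul _
  have hvm : Measurable (hv.mk v) := hv.measurable_mk
  have hA' : MorreyBound 2 ((n : ℝ) - 2) a' (C₀ * Na) :=
    (hA.congr ha.ae_eq_mk).const_mul (by norm_num) ha.measurable_mk C₀
  have hB' : MorreyBound 2 ((n : ℝ) - 2) b' (C₀ * Nb) :=
    (hB.congr hb.ae_eq_mk).const_mul (by norm_num) hb.measurable_mk C₀
  have hhalf : ∀ C ≤ C₂ + C₃, ∀ N, C * (C₀ * Na * N) ≤ 2⁻¹ * N := by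
    intro C hC N
    calc C * (C₀ * Na * N) = C * C₀ * Na * N := by ring
      _ ≤ T * ENNReal.ofReal (2 * (T.toReal + 1))⁻¹ * N := by
        rw [hT]
        exact mul_le_mul' (mul_le_mul' (mul_le_mul' hC le_rfl) hNa) le_rfl
      _ ≤ 2⁻¹ * N := mul_le_mul' hTε le_rfl
  have hG : MorreyBound p ((n : ℝ) - 1) (rieszOp b' fun _ => 1)
      (C₃ * (C₀ * Nb * unitBallVol n ^ (1 / p))) :=
    H₃ _ _ _ _ hbm measurable_const hB' (MorreyBound.one (by omega) hp0)
  have hle : ∀ᵐ x ∂volume.restrict (ball 0 1),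
      hv.mk v x ≤ rieszOp a' (hv.mk v) x + rieszOp b' (fun _ => 1) x := by
    filter_upwards [h, hv.ae_eq_mk] with x hx hvx
    rw [← hvx]
    refine hx.trans (le_of_eq ?_)
    unfold rieszOp
    rw [← lintegral_const_mul' _ _ hC₀, ← lintegral_add_left]
    · refine lintegral_congr_ae ?_
      filter_upwards [ha.ae_eq_mk, hb.ae_eq_mk, hv.ae_eq_mk] with y h1 h2 h3
      rw [ha', hb', h1, h2, h3]
      ring
    · exact ((measurable_powKernel _).comp (measurable_const.sub measurable_id)).mul (ham.mul hvm)
  obtain ⟨V, hVb, hVle⟩ := MorreyBound.of_le_rieszOp_add (by linarith : 1 ≤ p) ham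
    (measurable_rieszOp hbm measurable_const) hvm
    (fun u N hu hN => (H₂ _ _ _ _ ham hu hA' hN).mono (by norm_num) (fun _ => le_rfl)
      (hhalf C₂ le_self_add N))
    (fun u N hu hN => (H₃ _ _ _ _ ham hu hA' hN).mono hp0.le (fun _ => le_rfl)
      (hhalf C₃ le_add_self N))
    (hV.congr hv.ae_eq_mk) hNv hG hle
  have h1 := hVb 0 (by simp) 1 one_pos
  rw [Set.inter_self, Real.one_rpow, ENNReal.ofReal_one, mul_one] at h1
  refine le_trans (lintegral_mono_ae ?_) (h1.trans (le_of_eq ?_))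
  · filter_upwards [hVle, hv.ae_eq_mk] with x hx hvx
    rw [hvx]
    exact ENNReal.rpow_le_rpow hx hp0.le
  · congr 1
    ring

/-! ### Morrey norms and Morrey bounds -/

theorem morreyBound_morreyNorm {n : ℕ} {F : Type*} [NormedAddCommGroup F] {q lam : ℝ} (hq : 0 < q)
    (u : EuclideanSpace ℝ (Fin n) → F) :
    MorreyBound q ((n : ℝ) - lam) (fun x => ‖u x‖ₑ) (morreyNorm q lam (ball 0 1) u) := by
  intro x hx r hr
  set I := ∫⁻ y in ball x r ∩ ball 0 1, ‖u y‖ₑ ^ q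
  have h : (ENNReal.ofReal (r ^ lam / r ^ n) * I) ^ (1 / q) ≤ morreyNorm q lam (ball 0 1) u :=
    le_iSup₂_of_le x hx (le_iSup₂_of_le r hr le_rfl)
  have h' := ENNReal.rpow_le_rpow h hq.le
  rw [← ENNReal.rpow_mul, one_div_mul_cancel hq.ne', ENNReal.rpow_one] at h'
  have e : ENNReal.ofReal (r ^ ((n : ℝ) - lam)) * ENNReal.ofReal (r ^ lam / r ^ n) = 1 := by
    rw [← ENNReal.ofReal_mul (by positivity), ← Real.rpow_natCast r n, ← Real.rpow_sub hr,
      ← Real.rpow_add hr, sub_add_sub_cancel, sub_self, Real.rpow_zero, ENNReal.ofReal_one]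
  calc I = ENNReal.ofReal (r ^ ((n : ℝ) - lam)) * (ENNReal.ofReal (r ^ lam / r ^ n) * I) := by
        rw [← mul_assoc, e, one_mul]
    _ ≤ ENNReal.ofReal (r ^ ((n : ℝ) - lam)) * morreyNorm q lam (ball 0 1) u ^ q := by gcongr
    _ = _ := mul_comm _ _

/-- The inclusion of `M^{4,2}` of the unit ball into `M^{2,1}` (for `m = n`) and `M^{2,2}`
(for `m = n - 2`). -/
theorem MorreyBound.two_of_four {n : ℕ} {m : ℝ} (hm : 0 ≤ m) (hmn : m ≤ n)
    {u : EuclideanSpace ℝ (Fin n) → ℝ≥0∞} {N : ℝ≥0∞}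
    (hu : AEMeasurable u (volume.restrict (ball 0 1)))
    (h : MorreyBound 4 ((n : ℝ) - 2) u N) :
    MorreyBound 2 (((n : ℝ) - 2 + m) / 2) u (unitBallVol n ^ (1 / 4 : ℝ) * N) := by
  intro x hx r hr
  have hmeas : AEMeasurable u (volume.restrict (ball x r ∩ ball 0 1)) :=
    hu.mono_measure (Measure.restrict_mono Set.inter_subset_right le_rfl)
  have hh := ENNReal.lintegral_mul_norm_pow_le (hmeas.pow_const (4 : ℝ))
    (aemeasurable_const (b := (1 : ℝ≥0∞))) (by norm_num : (0 : ℝ) ≤ 1 / 2)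
    (by norm_num : (0 : ℝ) ≤ 1 / 2) (by norm_num)
  simp only [ENNReal.one_rpow, mul_one, ← ENNReal.rpow_mul, lintegral_one,
    Measure.restrict_apply_univ] at hh
  rw [show (4 : ℝ) * (1 / 2) = 2 by norm_num] at hh
  refine hh.trans ((mul_le_mul' (ENNReal.rpow_le_rpow (h x hx r hr) (by norm_num))
    (ENNReal.rpow_le_rpow (volume_ball_inter_le x hr hm hmn) (by norm_num))).trans (le_of_eq ?_))
  have h2 : (0 : ℝ) ≤ 1 / 2 := by norm_num
  rw [ENNReal.mul_rpow_of_nonneg _ _ h2, ENNReal.mul_rpow_of_nonneg _ _ h2,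
    ENNReal.mul_rpow_of_nonneg _ _ zero_le_two, ← ENNReal.rpow_mul, ← ENNReal.rpow_mul,
    ENNReal.ofReal_rpow_of_nonneg (by positivity) h2,
    ENNReal.ofReal_rpow_of_nonneg (by positivity) h2, ← Real.rpow_mul hr.le, ← Real.rpow_mul hr.le,
    show ((n : ℝ) - 2 + m) / 2 = ((n : ℝ) - 2) * (1 / 2) + m * (1 / 2) by ring, Real.rpow_add hr,
    ENNReal.ofReal_mul (by positivity), show (4 : ℝ) * (1 / 2) = 2 by norm_num,
    show (1 / 4 : ℝ) * 2 = 1 / 2 by norm_num]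
  ring

/-! ### Clifford multiplication on twisted spinors -/

/-- Clifford multiplication by `e_α` on `ℂ^L ⊗ ℝ^K`, as a real-linear operator. -/
noncomputable def twistedCliffordMul {n L : ℕ} (K : ℕ) (γ : Fin n → Matrix (Fin L) (Fin L) ℂ)
    (α : Fin n) : TwistedSpinor L K →L[ℝ] TwistedSpinor L K :=
  (TwistedEnd.op ((1 : Matrix (Fin K) (Fin K) ℂ) ⊗ₖ γ α)).restrictScalars ℝ

theorem twistedCliffordMul_apply_apply {n L K : ℕ} {γ : Fin n → Matrix (Fin L) (Fin L) ℂ}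
    (α β : Fin n) (v : TwistedSpinor L K) :
    twistedCliffordMul K γ α (twistedCliffordMul K γ β v) =
      TwistedEnd.op ((1 : Matrix (Fin K) (Fin K) ℂ) ⊗ₖ (γ α * γ β)) v := by
  have : (1 : Matrix (Fin K) (Fin K) ℂ) ⊗ₖ (γ α * γ β) =
      ((1 : Matrix (Fin K) (Fin K) ℂ) ⊗ₖ γ α) * ((1 : Matrix (Fin K) (Fin K) ℂ) ⊗ₖ γ β) := by
    rw [← Matrix.mul_kronecker_mul, one_mul]
  rw [this, TwistedEnd.op, map_mul]
  rfl

theorem twistedCliffordMul_anticomm {n L K : ℕ} {γ : Fin n → Matrix (Fin L) (Fin L) ℂ}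
    (hγ : IsCliffordMul γ) (α β : Fin n) (v : TwistedSpinor L K) :
    twistedCliffordMul K γ α (twistedCliffordMul K γ β v) +
      twistedCliffordMul K γ β (twistedCliffordMul K γ α v) =
      if α = β then (-2 : ℝ) • v else 0 := by
  rw [twistedCliffordMul_apply_apply, twistedCliffordMul_apply_apply, ← add_apply,
    TwistedEnd.op, TwistedEnd.op, ← map_add, ← Matrix.kronecker_add, hγ.anticomm]
  split_ifs
  · rw [Matrix.kronecker_smul, Matrix.one_kronecker_one, map_smul, map_one]
    ext i
    simp
  · simp

theorem norm_twistedCliffordMul {n L K : ℕ} {γ : Fin n → Matrix (Fin L) (Fin L) ℂ}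
    (hγ : IsCliffordMul γ) (α : Fin n) (v : TwistedSpinor L K) :
    ‖twistedCliffordMul K γ α v‖ = ‖v‖ := by
  set M := (1 : Matrix (Fin K) (Fin K) ℂ) ⊗ₖ γ α with hM
  set T := TwistedEnd.op M with hT
  have hstar : ContinuousLinearMap.adjoint T = -T := by
    rw [← ContinuousLinearMap.star_eq_adjoint, hT, TwistedEnd.op, ← map_star, ← map_neg]
    congr 1
    rw [Matrix.star_eq_conjTranspose, hM, Matrix.conjTranspose_kronecker, hγ.skew,
      Matrix.conjTranspose_one]
    ext i j
    simp [Matrix.kroneckerMap_apply]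
  have hTT : T (T v) = -v := by
    have h := twistedCliffordMul_anticomm (K := K) hγ α α v
    rw [if_pos rfl, ← two_smul ℝ] at h
    refine smul_right_injective _ (two_ne_zero (α := ℝ)) ?_
    rw [neg_smul, ← smul_neg] at h
    exact h
  have h : inner ℂ (T v) (T v) = inner ℂ v v := by
    rw [← ContinuousLinearMap.adjoint_inner_right, hstar, neg_apply, hTT, neg_neg]
  rw [inner_self_eq_norm_sq_to_K, inner_self_eq_norm_sq_to_K] at h
  have h' : ‖T v‖ ^ 2 = ‖v‖ ^ 2 := by exact_mod_cast h
  exact (sq_eq_sq₀ (norm_nonneg _) (norm_nonneg _)).1 h'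

/-! ### Cutoff functions -/

theorem exists_cutoff {n : ℕ} {U : Set (EuclideanSpace ℝ (Fin n))} (hU : closure U ⊆ ball 0 1) :
    ∃ (χ : EuclideanSpace ℝ (Fin n) → ℝ) (R : ℝ), ContDiff ℝ ∞ χ ∧ HasCompactSupport χ ∧
      tsupport χ ⊆ ball 0 1 ∧ (∀ y, |χ y| ≤ 1) ∧ (∀ y ∈ U, χ y = 1) ∧
      ∀ y α, |fderiv ℝ χ y (EuclideanSpace.single α 1)| ≤ R := by
  obtain ⟨ρ, hρ, hUρ⟩ := exists_lt_subset_ball isClosed_closure hU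
  have h1 : (0 : ℝ) < max ρ (1 / 2) := lt_max_of_lt_right (by norm_num)
  have h2 : max ρ (1 / 2) < 1 := max_lt hρ (by norm_num)
  let χ : ContDiffBump (0 : EuclideanSpace ℝ (Fin n)) :=
    ⟨max ρ (1 / 2), (max ρ (1 / 2) + 1) / 2, h1, by linarith⟩
  have hχ : ContDiff ℝ ∞ χ := χ.contDiff
  obtain ⟨R, hR⟩ := (χ.hasCompactSupport.fderiv ℝ).exists_bound_of_continuous
    (hχ.continuous_fderiv (by simp))
  refine ⟨χ, R, hχ, χ.hasCompactSupport, ?_, fun y => ?_, fun y hy => ?_, fun y α => ?_⟩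
  · rw [χ.tsupport_eq]
    refine closedBall_subset_ball ?_
    change (max ρ (1 / 2) + 1) / 2 < 1
    linarith
  · rw [abs_of_nonneg χ.nonneg]
    exact χ.le_one
  · refine χ.one_of_mem_closedBall ?_
    exact ball_subset_closedBall (ball_subset_ball (le_max_left _ _) (hUρ (subset_closure hy)))
  · have := (fderiv ℝ χ y).le_opNorm (EuclideanSpace.single α 1)
    rw [PiLp.norm_single, norm_one, mul_one] at this
    exact this.trans (hR y)

/-! ### The local estimate -/

/-- The local `L^p` estimate. The smallness threshold `ε₀` depends only on `n` and `p`: the cutoff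
adapted to `U` enters the source term and not the coefficient. -/
theorem IsWeakDiracSolution.exists_eLpNorm_le {p : ℝ} (hp : 4 < p) {n : ℕ} (hn : 2 ≤ n) :
    ∃ ε₀ : ℝ, 0 < ε₀ ∧
      ∀ U : Set (EuclideanSpace ℝ (Fin n)), IsOpen U → closure U ⊆ ball 0 1 →
        ∃ C : ℝ, 0 ≤ C ∧
        ∀ (L K : ℕ) (γ : Fin n → Matrix (Fin L) (Fin L) ℂ)
          (A : EuclideanSpace ℝ (Fin n) → TwistedEnd L K)
          (B φ : EuclideanSpace ℝ (Fin n) → TwistedSpinor L K),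
          IsCliffordMul γ →
          MemMorrey 4 2 (ball 0 1) φ →
          MemMorrey 2 2 (ball 0 1) (fun x => (A x).op) →
          MemMorrey 2 2 (ball 0 1) B →
          IsWeakDiracSolution γ (ball 0 1) A B φ →
          morreyNorm 2 2 (ball 0 1) (fun x => (A x).op) ≤ ENNReal.ofReal ε₀ →
          eLpNorm φ (ENNReal.ofReal p) (volume.restrict U) ≤
            ENNReal.ofReal C *
              (morreyNorm 4 2 (ball 0 1) φ + morreyNorm 2 2 (ball 0 1) B) := by
  have hp0 : 0 < p := by linarith
  have hn' : (2 : ℝ) ≤ n := by exact_mod_cast hn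
  obtain ⟨C₀, hC₀, H₀⟩ := exists_enorm_le_lintegral_powKernel (n := n) (by omega)
  obtain ⟨ε₀, hε₀, C, hC, H⟩ :=
    exists_lintegral_rpow_le_of_le_lintegral_powKernel hn (by linarith : 2 ≤ p) hC₀
  refine ⟨ε₀, hε₀, fun U hUo hU => ?_⟩
  obtain ⟨χ, R, hχ, hχc, hχs, hχ1, hχU, hχR⟩ := exists_cutoff hU
  set Q : ℝ≥0∞ := unitBallVol n ^ (1 / 4 : ℝ) with hQ
  have hQt : Q ≠ ⊤ := ENNReal.rpow_ne_top_of_nonneg (by norm_num) (unitBallVol_ne_top n)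
  set D : ℝ≥0∞ := C * (1 + ENNReal.ofReal (n * R) * Q) with hD
  have hDt : D ≠ ⊤ := by finiteness
  refine ⟨D.toReal, ENNReal.toReal_nonneg, ?_⟩
  intro L K γ A B φ hγ hφ hA hB hweak hsmall
  rw [ENNReal.ofReal_toReal hDt]
  set μ := volume.restrict (ball (0 : EuclideanSpace ℝ (Fin n)) 1) with hμ
  have : IsFiniteMeasure μ := ⟨by rw [hμ, Measure.restrict_apply_univ]; exact measure_ball_lt_top⟩
  have h42 : MemLp φ 2 μ := hφ.1.mono_exponent (by
    rw [← ENNReal.ofReal_ofNat]; exact ENNReal.ofReal_le_ofReal (by norm_num))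
  have hA2 : MemLp (fun x => (A x).op) 2 μ := by simpa using hA.1
  have hB2 : MemLp B 2 μ := by simpa using hB.1
  have hφm : AEStronglyMeasurable φ μ := h42.1
  have hφi : Integrable φ μ := h42.integrable one_le_two
  have hAφm : AEStronglyMeasurable (fun x => (A x).op (φ x)) μ :=
    (isBoundedBilinearMap_apply (𝕜 := ℂ)).continuous.comp_aestronglyMeasurable (hA2.1.prodMk hφm)
  have hAφ : Integrable (fun x => (A x).op (φ x)) μ := by
    refine (h42.norm.integrable_mul hA2.norm).mono hAφm (Filter.Eventually.of_forall fun x => ?_)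
    rw [Pi.mul_apply, norm_mul, norm_norm, norm_norm, mul_comm]
    exact (A x).op.le_opNorm (φ x)
  have hf : Integrable (fun x => (A x).op (φ x) + B x) μ :=
    hAφ.add (hB2.integrable one_le_two)
  have hrep := H₀ (TwistedSpinor L K) (twistedCliffordMul K γ) χ R
    (fun x => (A x).op (φ x) + B x) φ (twistedCliffordMul_anticomm hγ)
    (fun α v => (norm_twistedCliffordMul hγ α v).le) hχ hχc hχs hχR hf hφi hweak
  have hφM : MorreyBound 4 ((n : ℝ) - 2) (fun x => ‖φ x‖ₑ) (morreyNorm 4 2 (ball 0 1) φ) :=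
    morreyBound_morreyNorm (by norm_num) φ
  have hφ22 : MorreyBound 2 ((n : ℝ) - 2) (fun x => ‖φ x‖ₑ)
      (Q * morreyNorm 4 2 (ball 0 1) φ) := by
    have := hφM.two_of_four (m := (n : ℝ) - 2) (by linarith) (by linarith) hφm.enorm
    rwa [add_self_div_two] at this
  have hφ21 : MorreyBound 2 ((n : ℝ) - 1) (fun x => ‖φ x‖ₑ)
      (Q * morreyNorm 4 2 (ball 0 1) φ) := by
    have := hφM.two_of_four (m := (n : ℝ)) (by linarith) le_rfl hφm.enorm
    rwa [show ((n : ℝ) - 2 + n) / 2 = n - 1 by ring] at this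
  have hχe : ∀ y, ‖χ y‖ₑ ≤ 1 := fun y => by
    rw [← ofReal_norm, Real.norm_eq_abs]
    exact ENNReal.ofReal_le_one.2 (hχ1 y)
  set b : EuclideanSpace ℝ (Fin n) → ℝ≥0∞ := fun y => ‖B y‖ₑ + ENNReal.ofReal (n * R) * ‖φ y‖ₑ
    with hb
  set Nb := morreyNorm 2 2 (ball 0 1) B +
    ENNReal.ofReal (n * R) * (Q * morreyNorm 4 2 (ball 0 1) φ) with hNb
  have hbM : MorreyBound 2 ((n : ℝ) - 2) b Nb := by
    have hBm := hB2.1.enorm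
    have hφm' := hφm.enorm
    have h1 := ((morreyBound_morreyNorm (lam := 2) two_pos B).congr hBm.ae_eq_mk).add one_le_two
      ((hφ22.congr hφm'.ae_eq_mk).const_mul zero_le_two hφm'.measurable_mk
        (ENNReal.ofReal (n * R))) hBm.measurable_mk (hφm'.measurable_mk.const_mul _)
    refine h1.congr ?_
    filter_upwards [hBm.ae_eq_mk, hφm'.ae_eq_mk] with x hx1 hx2
    rw [← hx1, ← hx2]
  have hmain := H (fun x => ‖(A x).op‖ₑ) b (fun x => ‖χ x • φ x‖ₑ)
    (morreyNorm 2 2 (ball 0 1) fun x => (A x).op) Nb (Q * morreyNorm 4 2 (ball 0 1) φ)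
    hA2.1.enorm (hB2.1.enorm.add (hφm.enorm.const_mul _))
    (hχ.continuous.aestronglyMeasurable.smul hφm).enorm
    (morreyBound_morreyNorm two_pos _) hsmall hbM
    (hφ21.mono zero_le_two (fun x => by
      rw [enorm_smul]; exact mul_le_of_le_one_left zero_le (hχe x)) le_rfl)
    (ENNReal.mul_ne_top hQt hφ.2.ne) (by
      filter_upwards [hrep] with x hx
      refine hx.trans (mul_le_mul' le_rfl (lintegral_mono fun y => mul_le_mul' le_rfl ?_))
      rw [hb, ← add_assoc]
      refine add_le_add ?_ le_rfl
      rw [smul_add]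
      refine (enorm_add_le _ _).trans (add_le_add ?_ ?_)
      · rw [enorm_smul, enorm_smul, mul_left_comm]
        exact mul_le_mul' le_rfl ((A y).op.le_opENorm (φ y))
      · rw [enorm_smul]
        exact mul_le_of_le_one_left zero_le (hχe y))
  have hUB : U ⊆ ball 0 1 := subset_closure.trans hU
  rw [eLpNorm_eq_lintegral_rpow_enorm_toReal (by simpa using hp0) ENNReal.ofReal_ne_top,
    ENNReal.toReal_ofReal hp0.le]
  have h1 : ∫⁻ x in U, ‖φ x‖ₑ ^ p ≤ (C * Nb) ^ p := by
    refine le_trans ?_ hmain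
    refine le_trans (le_of_eq ?_) (lintegral_mono_set hUB)
    refine setLIntegral_congr_fun hUo.measurableSet fun x hx => ?_
    simp only [hχU x hx, one_smul]
  refine (ENNReal.rpow_le_rpow h1 (by positivity)).trans ?_
  rw [← ENNReal.rpow_mul, mul_one_div_cancel hp0.ne', ENNReal.rpow_one, hD, hNb, mul_assoc]
  refine mul_le_mul' le_rfl ?_
  set N₁ := morreyNorm 4 2 (ball 0 1) φ
  set N₂ := morreyNorm 2 2 (ball 0 1) B
  calc N₂ + ENNReal.ofReal (n * R) * (Q * N₁) = 1 * N₂ + ENNReal.ofReal (n * R) * Q * N₁ := by ring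
    _ ≤ (1 + ENNReal.ofReal (n * R) * Q) * N₂ + (1 + ENNReal.ofReal (n * R) * Q) * N₁ := by
        gcongr
        · exact le_self_add
        · exact le_add_self
    _ = _ := by ring

theorem memLocLp_of_eLpNorm_lt_top {n : ℕ} {F : Type*} [NormedAddCommGroup F] {p : ℝ}
    {u : EuclideanSpace ℝ (Fin n) → F}
    (hu : AEStronglyMeasurable u (volume.restrict (ball 0 1)))
    (h : ∀ U : Set (EuclideanSpace ℝ (Fin n)), IsOpen U → closure U ⊆ ball 0 1 →
      eLpNorm u (ENNReal.ofReal p) (volume.restrict U) < ⊤) : MemLocLp p (ball 0 1) u := by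
  intro Q hQ hQB
  obtain ⟨ρ, hρ, hQρ⟩ := exists_lt_subset_ball hQ.isClosed hQB
  refine ⟨hu.mono_measure (Measure.restrict_mono hQB le_rfl), ?_⟩
  exact (eLpNorm_mono_measure u (Measure.restrict_mono hQρ le_rfl)).trans_lt
    (h _ isOpen_ball (closure_ball_subset_closedBall.trans (closedBall_subset_ball hρ)))

/-- In dimension two the scaling weight of `M^{q,2}` is `1`. -/
theorem morreyNorm_two_le_eLpNorm {F : Type*} [NormedAddCommGroup F] {q : ℝ} (hq : 0 < q)
    (u : EuclideanSpace ℝ (Fin 2) → F) :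
    morreyNorm q 2 (ball 0 1) u ≤ eLpNorm u (ENNReal.ofReal q) (volume.restrict (ball 0 1)) := by
  rw [eLpNorm_eq_lintegral_rpow_enorm_toReal (by simpa using hq) ENNReal.ofReal_ne_top,
    ENNReal.toReal_ofReal hq.le]
  refine iSup₂_le fun x _ => iSup₂_le fun r hr => ?_
  refine ENNReal.rpow_le_rpow ?_ (by positivity)
  rw [Real.rpow_two, div_self (by positivity), ENNReal.ofReal_one, one_mul]
  exact lintegral_mono_set Set.inter_subset_right

theorem lemma6p1 (p : ℝ) (hp : 4 < p) :
    (∀ n : ℕ, 2 ≤ n → ∃ ε₀ : ℝ, 0 < ε₀ ∧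
      (∀ (L K : ℕ) (γ : Fin n → Matrix (Fin L) (Fin L) ℂ)
        (A : EuclideanSpace ℝ (Fin n) → TwistedEnd L K)
        (B φ : EuclideanSpace ℝ (Fin n) → TwistedSpinor L K),
        IsCliffordMul γ →
        MemMorrey 4 2 (ball 0 1) φ →
        MemMorrey 2 2 (ball 0 1) (fun x => (A x).op) →
        MemMorrey 2 2 (ball 0 1) B →
        IsWeakDiracSolution γ (ball 0 1) A B φ →
        morreyNorm 2 2 (ball 0 1) (fun x => (A x).op) ≤ ENNReal.ofReal ε₀ →
        MemLocLp p (ball 0 1) φ) ∧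
      (∀ U : Set (EuclideanSpace ℝ (Fin n)), IsOpen U → closure U ⊆ ball 0 1 →
        ∃ C : ℝ, 0 ≤ C ∧
        ∀ (L K : ℕ) (γ : Fin n → Matrix (Fin L) (Fin L) ℂ)
          (A : EuclideanSpace ℝ (Fin n) → TwistedEnd L K)
          (B φ : EuclideanSpace ℝ (Fin n) → TwistedSpinor L K),
          IsCliffordMul γ →
          MemMorrey 4 2 (ball 0 1) φ →
          MemMorrey 2 2 (ball 0 1) (fun x => (A x).op) →
          MemMorrey 2 2 (ball 0 1) B →
          IsWeakDiracSolution γ (ball 0 1) A B φ →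
          morreyNorm 2 2 (ball 0 1) (fun x => (A x).op) ≤ ENNReal.ofReal ε₀ →
          eLpNorm φ (ENNReal.ofReal p) (volume.restrict U) ≤
            ENNReal.ofReal C *
              (morreyNorm 4 2 (ball 0 1) φ + morreyNorm 2 2 (ball 0 1) B))) ∧
    (∃ ε₀ : ℝ, 0 < ε₀ ∧
      ∀ (K : ℕ) (γ : Fin 2 → Matrix (Fin 2) (Fin 2) ℂ)
        (A : EuclideanSpace ℝ (Fin 2) → TwistedEnd 2 K)
        (B φ : EuclideanSpace ℝ (Fin 2) → TwistedSpinor 2 K),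
        IsCliffordMul γ →
        MemLp φ 4 (volume.restrict (ball 0 1)) →
        MemLp (fun x => (A x).op) 2 (volume.restrict (ball 0 1)) →
        MemLp B 2 (volume.restrict (ball 0 1)) →
        IsWeakDiracSolution γ (ball 0 1) A B φ →
        eLpNorm (fun x => (A x).op) 2 (volume.restrict (ball 0 1)) ≤ ENNReal.ofReal ε₀ →
        MemLocLp p (ball 0 1) φ) := by
  have hloc : ∀ {n L K : ℕ} {N : ℝ≥0∞} {φ : EuclideanSpace ℝ (Fin n) → TwistedSpinor L K},
      MemMorrey 4 2 (ball 0 1) φ → N < ⊤ →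
      (∀ U : Set (EuclideanSpace ℝ (Fin n)), IsOpen U → closure U ⊆ ball 0 1 → ∃ C : ℝ,
        eLpNorm φ (ENNReal.ofReal p) (volume.restrict U) ≤
          ENNReal.ofReal C * (morreyNorm 4 2 (ball 0 1) φ + N)) →
      MemLocLp p (ball 0 1) φ := by
    intro n L K N φ hφ hN h
    refine memLocLp_of_eLpNorm_lt_top hφ.1.1 fun U hU hUB => ?_
    obtain ⟨C, hC⟩ := h U hU hUB
    exact hC.trans_lt (ENNReal.mul_lt_top ENNReal.ofReal_lt_top (ENNReal.add_lt_top.2 ⟨hφ.2, hN⟩))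
  refine ⟨fun n hn => ?_, ?_⟩
  · obtain ⟨ε₀, hε₀, H⟩ := IsWeakDiracSolution.exists_eLpNorm_le hp hn
    refine ⟨ε₀, hε₀, ?_, H⟩
    intro L K γ A B φ hγ hφ hA hB hweak hsmall
    refine hloc hφ hB.2 fun U hU hUB => ?_
    obtain ⟨C, -, hC⟩ := H U hU hUB
    exact ⟨C, hC L K γ A B φ hγ hφ hA hB hweak hsmall⟩
  · obtain ⟨ε₀, hε₀, H⟩ := IsWeakDiracSolution.exists_eLpNorm_le hp (le_refl 2)
    refine ⟨ε₀, hε₀, ?_⟩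
    intro K γ A B φ hγ hφ hA hB hweak hsmall
    have hmem : ∀ {F : Type} [NormedAddCommGroup F] {q : ℝ} {u : EuclideanSpace ℝ (Fin 2) → F},
        0 < q → MemLp u (ENNReal.ofReal q) (volume.restrict (ball 0 1)) →
        MemMorrey q 2 (ball 0 1) u := fun hq hu =>
      ⟨hu, (morreyNorm_two_le_eLpNorm hq _).trans_lt hu.2⟩
    have hφ' : MemMorrey 4 2 (ball 0 1) φ := hmem (by norm_num) (by simpa using hφ)
    have hA' : MemMorrey 2 2 (ball 0 1) (fun x => (A x).op) := hmem two_pos (by simpa using hA)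
    have hB' : MemMorrey 2 2 (ball 0 1) B := hmem two_pos (by simpa using hB)
    refine hloc hφ' hB'.2 fun U hU hUB => ?_
    obtain ⟨C, -, hC⟩ := H U hU hUB
    refine ⟨C, hC 2 K γ A B φ hγ hφ' hA' hB' hweak (le_trans ?_ hsmall)⟩
    simpa using morreyNorm_two_le_eLpNorm two_pos fun x => (A x).op
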